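/- Let $X=\mathbb{A}^2_{\mathbb{Q}}=\operatorname{Spec}\mathbb{Q}[x,y]$, let $P=(1,0)$, $Q=(0,1)$, and let $\pi\colon\widetilde X\to X$ be the blow-up of $X$ at $P$ and $Q$, with exceptional divisors $E_P=\pi^{-1}(P)$ and $E_Q=\pi^{-1}(Q)$. For $F\in\mathbb{Q}[x,y]$ let $\operatorname{ord}_{E_P}(F)$ and $\operatorname{ord}_{E_Q}(F)$ be the orders of vanishing of (the pullback of) $F$ along $E_P$ and $E_Q$ (with value $\infty$ for $F=0$). Put $g=1-x^2-y^2$ and, for an integer $t\ge 0$, $$\omega_{F,t}=\frac{F\,dx\,dy}{g^{t+1}}.$$ The form $\omega_{F,t}$ is called integrable if $\operatorname{ord}_{E_P}(F)\ge t$ and $\operatorname{ord}_{E_Q}(F)\ge t$. Let $\sigma$ be the automorphism of the $\mathbb{Q}$-algebra $\mathbb{Q}[x,y]$ with $\sigma(x)=-y$ and $\sigma(y)=x$, let $\Delta=\{(x,y)\in\mathbb{R}^2 : x\ge 0,\ y\ge 0,\ 1-x-y\ge 0\}$, and let $\mathbf{G}=\sum_{n\ge 0}\frac{(-1)^n}{(2n+1)^2}$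 be the Catalan constant. **Theorem.** Let $t\ge 0$ be an integer and let $F\in\mathbb{Q}[x,y]$ satisfy $\sigma(F)=F$ and be such that $\omega_{F,t}$ is integrable. Then the integral $\int_\Delta \omega_{F,t}$ converges absolutely, and its value is $a+b\,\mathbf{G}$ for some $a,b\in\mathbb{Q}$. -/

import Mathlib

open MeasureTheory

namespace CatalanForms

noncomputable section

/-- The affine open subset `β₁ ≠ 0, α₂ ≠ 0` of the blow-up `X̃ ⊆ 𝔸² × ℙ¹ × ℙ¹` of the affine plane
`X` over `ℚ` at `P = (1, 0)` and `Q = (0, 1)`, where `X̃` is the subvariety cut out by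
`α₁ (x - 1) = β₁ y` and `α₂ x = β₂ (y - 1)`. This is its coordinate ring: the variables `0, 1, 2, 3`
are `x, y, u = α₁ / β₁, v = β₂ / α₂`. This open set meets both exceptional divisors. -/
abbrev BlowUpChart : Type :=
  MvPolynomial (Fin 4) ℚ ⧸
    (Ideal.span {MvPolynomial.X 2 * (MvPolynomial.X 0 - 1) - MvPolynomial.X 1,
      MvPolynomial.X 0 - MvPolynomial.X 3 * (MvPolynomial.X 1 - 1)} :
        Ideal (MvPolynomial (Fin 4) ℚ))

/-- The coordinate functions `x, y, u, v` on the open subset of the blow-up. -/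
def coord (i : Fin 4) : BlowUpChart := Ideal.Quotient.mk _ (MvPolynomial.X i)

/-- Pullback of regular functions along the blow-up map `π : X̃ → X`. -/
def pullback : MvPolynomial (Fin 2) ℚ →ₐ[ℚ] BlowUpChart :=
  MvPolynomial.aeval ![coord 0, coord 1]

/-- The ideal of the exceptional divisor `E_P = π⁻¹(P)`, `P = (1, 0)`. -/
def idealEP : Ideal BlowUpChart :=
  Ideal.span {pullback (MvPolynomial.X 0 - 1), pullback (MvPolynomial.X 1)}

/-- The ideal of the exceptional divisor `E_Q = π⁻¹(Q)`, `Q = (0, 1)`. -/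
def idealEQ : Ideal BlowUpChart :=
  Ideal.span {pullback (MvPolynomial.X 0), pullback (MvPolynomial.X 1 - 1)}

theorem coord_rel₁ : coord 2 * (coord 0 - 1) = coord 1 := by
  rw [← sub_eq_zero]
  exact Ideal.Quotient.eq_zero_iff_mem.2 (Ideal.subset_span (by simp))

theorem coord_rel₂ : coord 0 = coord 3 * (coord 1 - 1) := by
  rw [← sub_eq_zero]
  exact Ideal.Quotient.eq_zero_iff_mem.2 (Ideal.subset_span (by simp))

/-- Restriction of functions to `E_P`, on which `u` is a coordinate and `x = 1, y = 0, v = -1`. -/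
def restrictEP : BlowUpChart →ₐ[ℚ] Polynomial ℚ :=
  Ideal.Quotient.liftₐ _ (MvPolynomial.aeval ![1, 0, Polynomial.X, -1]) (by
    intro a ha
    refine (Ideal.span_le (I := RingHom.ker _)).2 ?_ ha
    rintro b (rfl | rfl) <;> simp [RingHom.mem_ker])

/-- Restriction of functions to `E_Q`, on which `v` is a coordinate and `x = 0, y = 1, u = -1`. -/
def restrictEQ : BlowUpChart →ₐ[ℚ] Polynomial ℚ :=
  Ideal.Quotient.liftₐ _ (MvPolynomial.aeval ![0, 1, -1, Polynomial.X]) (by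
    intro a ha
    refine (Ideal.span_le (I := RingHom.ker _)).2 ?_ ha
    rintro b (rfl | rfl) <;> simp [RingHom.mem_ker])

theorem restrictEP_coord (i : Fin 4) :
    restrictEP (coord i) = (![1, 0, Polynomial.X, -1] : Fin 4 → Polynomial ℚ) i :=
  MvPolynomial.aeval_X (![1, 0, Polynomial.X, -1] : Fin 4 → Polynomial ℚ) i

theorem restrictEQ_coord (i : Fin 4) :
    restrictEQ (coord i) = (![0, 1, -1, Polynomial.X] : Fin 4 → Polynomial ℚ) i :=
  MvPolynomial.aeval_X (![0, 1, -1, Polynomial.X] : Fin 4 → Polynomial ℚ) i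

theorem idealEP_eq_ker : idealEP = RingHom.ker restrictEP := by
  apply le_antisymm
  · refine Ideal.span_le.2 ?_
    rintro b (rfl | rfl) <;> simp [RingHom.mem_ker, pullback, restrictEP_coord]
  · have hx : Ideal.Quotient.mk idealEP (coord 0) = 1 := by
      rw [← sub_eq_zero, ← map_one (Ideal.Quotient.mk idealEP), ← map_sub]
      exact Ideal.Quotient.eq_zero_iff_mem.2 (Ideal.subset_span (by simp [pullback]))
    have hy : Ideal.Quotient.mk idealEP (coord 1) = 0 :=
      Ideal.Quotient.eq_zero_iff_mem.2 (Ideal.subset_span (by simp [pullback]))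
    have hv : Ideal.Quotient.mk idealEP (coord 3) = -1 := by
      have := congrArg (Ideal.Quotient.mk idealEP) coord_rel₂
      rw [map_mul, map_sub, hx, hy, map_one] at this
      linear_combination this
    have key : (Polynomial.aeval (Ideal.Quotient.mk idealEP (coord 2))).comp restrictEP
        = Ideal.Quotient.mkₐ ℚ idealEP := by
      apply Ideal.Quotient.algHom_ext
      apply MvPolynomial.algHom_ext
      intro i
      change Polynomial.aeval (Ideal.Quotient.mk idealEP (coord 2)) (restrictEP (coord i))
        = Ideal.Quotient.mk idealEP (coord i)
      rw [restrictEP_coord]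
      fin_cases i <;> simp [hx, hy, hv]
    intro r hr
    have := DFunLike.congr_fun key r
    rw [AlgHom.comp_apply, (RingHom.mem_ker).1 hr, map_zero] at this
    exact Ideal.Quotient.eq_zero_iff_mem.1 this.symm

theorem idealEQ_eq_ker : idealEQ = RingHom.ker restrictEQ := by
  apply le_antisymm
  · refine Ideal.span_le.2 ?_
    rintro b (rfl | rfl) <;> simp [RingHom.mem_ker, pullback, restrictEQ_coord]
  · have hx : Ideal.Quotient.mk idealEQ (coord 0) = 0 :=
      Ideal.Quotient.eq_zero_iff_mem.2 (Ideal.subset_span (by simp [pullback]))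
    have hy : Ideal.Quotient.mk idealEQ (coord 1) = 1 := by
      rw [← sub_eq_zero, ← map_one (Ideal.Quotient.mk idealEQ), ← map_sub]
      exact Ideal.Quotient.eq_zero_iff_mem.2 (Ideal.subset_span (by simp [pullback]))
    have hu : Ideal.Quotient.mk idealEQ (coord 2) = -1 := by
      have := congrArg (Ideal.Quotient.mk idealEQ) coord_rel₁
      rw [map_mul, map_sub, hx, hy, map_one] at this
      linear_combination -this
    have key : (Polynomial.aeval (Ideal.Quotient.mk idealEQ (coord 3))).comp restrictEQ
        = Ideal.Quotient.mkₐ ℚ idealEQ := by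
      apply Ideal.Quotient.algHom_ext
      apply MvPolynomial.algHom_ext
      intro i
      change Polynomial.aeval (Ideal.Quotient.mk idealEQ (coord 3)) (restrictEQ (coord i))
        = Ideal.Quotient.mk idealEQ (coord i)
      rw [restrictEQ_coord]
      fin_cases i <;> simp [hx, hy, hu]
    intro r hr
    have := DFunLike.congr_fun key r
    rw [AlgHom.comp_apply, (RingHom.mem_ker).1 hr, map_zero] at this
    exact Ideal.Quotient.eq_zero_iff_mem.1 this.symm

instance idealEP_isPrime : idealEP.IsPrime := by
  rw [idealEP_eq_ker]
  exact RingHom.ker_isPrime _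

instance idealEQ_isPrime : idealEQ.IsPrime := by
  rw [idealEQ_eq_ker]
  exact RingHom.ker_isPrime _

/-- The order of vanishing of `f ∈ R` along the prime divisor of `Spec R` with ideal `p`: the order
(length of `A / f A`) of `f` in the local ring `A = R_p` at the generic point of the divisor. -/
def ordAlong {R : Type} [CommRing R] (p : Ideal R) [p.IsPrime] (f : R) : ℕ∞ :=
  @Ring.ord (Localization.AtPrime p) CommRing.toRing (algebraMap R (Localization.AtPrime p) f)

/-- The order of vanishing of `F` along `E_P`, i.e. the coefficient of `E_P` in the Weil divisor of
`F` on `X̃`: the order of `F` in the local ring of `X̃` at the generic point of `E_P`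
(it is `⊤` for `F = 0`). -/
def ordEP (F : MvPolynomial (Fin 2) ℚ) : ℕ∞ :=
  ordAlong idealEP (pullback F)

/-- The order of vanishing of `F` along `E_Q`, i.e. the coefficient of `E_Q` in the Weil divisor of
`F` on `X̃`. -/
def ordEQ (F : MvPolynomial (Fin 2) ℚ) : ℕ∞ :=
  ordAlong idealEQ (pullback F)

/-- The 2-form `ω_{F,t} = F dx dy / g ^ (t + 1)`, `g = 1 - x ^ 2 - y ^ 2`, is integrable:
`F` vanishes to order at least `t` along both exceptional divisors. -/
def IsIntegrableForm (F : MvPolynomial (Fin 2) ℚ) (t : ℕ) : Prop :=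
  (t : ℕ∞) ≤ ordEP F ∧ (t : ℕ∞) ≤ ordEQ F

/-- The endomorphism `σ` of `ℚ[x, y]` with `x ↦ -y`, `y ↦ x`. -/
def sigma : MvPolynomial (Fin 2) ℚ →ₐ[ℚ] MvPolynomial (Fin 2) ℚ :=
  MvPolynomial.aeval ![-MvPolynomial.X 1, MvPolynomial.X 0]

/-- The simplex `Δ = {(x, y) : x, y, 1 - x - y ≥ 0}`. -/
def simplex : Set (ℝ × ℝ) := {p | 0 ≤ p.1 ∧ 0 ≤ p.2 ∧ 0 ≤ 1 - p.1 - p.2}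

/-- The density `F(x, y) / (1 - x ^ 2 - y ^ 2) ^ (t + 1)` of `ω_{F,t}` with respect to `dx dy`. -/
def density (F : MvPolynomial (Fin 2) ℚ) (t : ℕ) (p : ℝ × ℝ) : ℝ :=
  MvPolynomial.aeval ![p.1, p.2] F / (1 - p.1 ^ 2 - p.2 ^ 2) ^ (t + 1)

/-- The Catalan constant `G = 1 - 1/3² + 1/5² - 1/7² + ⋯` (an absolutely convergent series). -/
def catalanConstant : ℝ := ∑' n : ℕ, (-1 : ℝ) ^ n / (2 * (n : ℝ) + 1) ^ 2

end

end CatalanForms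

/-! Integrability bounds the integrand, and Stokes' theorem reduces the integral to one explicit
period.

Vanishing to order `t` along both exceptional divisors forces `F ∈ pointsIdeal ^ t`
(`mem_pointsIdeal_pow_of_isIntegrableForm`). On the simplex this gives `|F| ≤ M g ^ t`
(`exists_abs_value_le_conic_pow`), so the density is dominated by a multiple of `1 / g`, which is
integrable. In the coordinates `(l, y) ↦ (l (1 - y), l y)`, with Jacobian `l`, one has `g = 1 - l²
(1 - 2y + 2y²)`, and all integrals become iterated integrals over a square.

Let `E` be the Euler field and `R` the rotation field. The divergence of `(H / g ^ n) E` is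
`radialDivergence H n / g ^ (n + 1)`. As `E` is tangent to the axes, only the side `x + y = 1`
contributes to its integral. There `g = 2y(1 - y)`, so for `H ∈ pointsIdeal ^ n` the boundary term
is the integral of a rational polynomial (`exists_rat_eq_integral_radial`). Since `E g = -2 (1 -
g)`, subtracting a multiple of such a divergence lowers the pole order by one while preserving
integrability and `σ`-invariance.

For a simple pole, write `F = c + g A + R H` with `H` invariant and vanishing at both points
(`exists_sigma_invariant_primitive`). The term `g A` integrates a polynomial. As `R` annihilates `g`
and has divergence zero, `R H / g` is again a divergence; `σ`-invariance cancels the contributions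
of the two axes, and the third side gives a rational number (`exists_rat_eq_integral_rotational`).
The constant contributes `c` times the integral of `1 / g`, which is the Catalan constant
(`integral_unitSquare_density_one`). -/

namespace CatalanForms

noncomputable section

/-! ### Vanishing along the exceptional divisors and powers of the point ideals -/

open MvPolynomial in
/-- The maximal ideal of the point `P = (1, 0)` in `ℚ[x, y]`. -/
def pointIdealP : Ideal (MvPolynomial (Fin 2) ℚ) := Ideal.span {X 0 - 1, X 1}

open MvPolynomial in
/-- The maximal ideal of the point `Q = (0, 1)` in `ℚ[x, y]`. -/
def pointIdealQ : Ideal (MvPolynomial (Fin 2) ℚ) := Ideal.span {X 1 - 1, X 0}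

/-- The ideal of functions vanishing at both blown-up points. -/
def pointsIdeal : Ideal (MvPolynomial (Fin 2) ℚ) := pointIdealP * pointIdealQ

/-- Elements of a power of an ideal with two generators are forms in the generators. -/
theorem exists_form_of_mem_span_pair_pow {S : Type*} [CommRing S] (a b : S) (k : ℕ) :
    ∀ F ∈ (Ideal.span {a, b} : Ideal S) ^ k,
      ∃ c : ℕ → S, F = ∑ j ∈ Finset.range (k + 1), c j * (a ^ (k - j) * b ^ j) := by
  induction k with
  | zero => intro F _; exact ⟨fun _ => F, by simp⟩
  | succ k ih =>
    intro F hF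
    rw [pow_succ', Ideal.span_insert, Submodule.sup_mul, Submodule.mem_sup] at hF
    obtain ⟨y, hy, z, hz, rfl⟩ := hF
    obtain ⟨y', hy', rfl⟩ := Ideal.mem_span_singleton_mul.1 hy
    obtain ⟨z', hz', rfl⟩ := Ideal.mem_span_singleton_mul.1 hz
    rw [← Ideal.span_insert] at hy' hz'
    obtain ⟨c, rfl⟩ := ih _ hy'
    obtain ⟨d, rfl⟩ := ih _ hz'
    -- The form with coefficients `c`, multiplied by `a`, fills the indices `0, …, k`; the one with
    -- coefficients `d`, multiplied by `b`, is shifted to `1, …, k + 1`.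
    refine ⟨fun j => (if j = k + 1 then 0 else c j) + (if j = 0 then 0 else d (j - 1)), ?_⟩
    simp_rw [add_mul]
    rw [Finset.sum_add_distrib]
    congr 1
    · rw [Finset.mul_sum, Finset.sum_range_succ _ (k + 1)]
      simp only [if_true, zero_mul, add_zero]
      refine Finset.sum_congr rfl fun j hj => ?_
      have hj' := Finset.mem_range.1 hj
      rw [if_neg (by omega), show k + 1 - j = (k - j) + 1 by omega, pow_succ]
      ring
    · rw [Finset.mul_sum, Finset.sum_range_succ' _ (k + 1)]
      simp only [if_true, zero_mul, add_zero]
      refine Finset.sum_congr rfl fun j hj => ?_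
      rw [if_neg (by omega), show k + 1 - (j + 1) = k - j by omega, pow_succ, Nat.add_sub_cancel]
      ring

-- Multiplication by `b` maps `R / (a)` to `R / (a b)` with cokernel `R / (b)`. Only an inequality
-- is claimed because this map need not be injective; thus no regularity of `a` or `b` is needed.
open Pointwise in
theorem ord_mul_le {R : Type*} [CommRing R] (a b : R) :
    Ring.ord R (a * b) ≤ Ring.ord R a + Ring.ord R b := by
  have lem : b • (Ideal.span {a} : Ideal R) = Ideal.span {a * b} := by
    rw [← Submodule.singleton_set_smul, mul_comm]
    simp [← Ideal.submodule_span_eq, Submodule.set_smul_span]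
  have h := Module.length_eq_add_of_exact
    (LinearMap.range (Ideal.mulQuot b (Ideal.span {a}))).subtype
    (Ideal.quotOfMul b (Ideal.span {a})) (Submodule.subtype_injective _)
    (Ideal.quotOfMul_surjective (Ideal.span {a}))
    (by
      have := Ideal.exact_mulQuot_quotOfMul (a := b) (Ideal.span {a})
      rw [LinearMap.exact_iff] at this ⊢
      rw [this, Submodule.range_subtype])
  have h2 := Module.length_le_of_surjective
    (LinearMap.rangeRestrict (Ideal.mulQuot b (Ideal.span {a})))
    (LinearMap.surjective_rangeRestrict _)
  rw [Ring.ord, ← lem, h]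
  exact add_le_add_left h2 _

theorem ord_pow_le {R : Type*} [CommRing R] (a : R) (h : Ring.ord R a ≤ 1) (k : ℕ) :
    Ring.ord R (a ^ k) ≤ k := by
  induction k with
  | zero => simp
  | succ k ih =>
    rw [pow_succ]
    refine (ord_mul_le _ _).trans ?_
    push_cast
    gcongr

/-- In the local ring at `p` the factor `s` is a unit and `e` generates the maximal ideal, so the
quotient by `e` is a field, of length one. -/
theorem ordAlong_pow_mul_le {R : Type} [CommRing R] (p : Ideal R) [p.IsPrime] (e s : R)
    (hp : p = Ideal.span {e}) (hs : s ∉ p) (k : ℕ) : ordAlong p (e ^ k * s) ≤ k := by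
  have hu : IsUnit (algebraMap R (Localization.AtPrime p) s) :=
    IsLocalization.map_units (Localization.AtPrime p) (⟨s, hs⟩ : p.primeCompl)
  unfold ordAlong
  rw [map_mul, Ring.ord_mul_of_isUnit_right hu, map_pow]
  refine ord_pow_le _ ?_ k
  have hm := Localization.AtPrime.map_eq_maximalIdeal (I := p)
  have hm' : IsLocalRing.maximalIdeal (Localization.AtPrime p)
      = Ideal.span {algebraMap R (Localization.AtPrime p) e} := by
    rw [← hm, ← Set.image_singleton, ← Ideal.map_span, ← hp]
  refine le_of_eq ?_
  rw [Ring.ord, Module.length_eq_one_iff, isSimpleModule_iff_isCoatom, ← hm']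
  exact (IsLocalRing.maximalIdeal.isMaximal _).out

/-- Common argument for both exceptional divisors: `e` is a local equation, `u` a coordinate along
the divisor, `ρ` the restriction to it, and `ε` evaluation at the blown-up point. A form of degree
`k` in `a, b` pulls back to `e ^ k` times a polynomial in `u`. If the order exceeds `k`, this
polynomial restricts to zero on the divisor, so every coefficient vanishes at the point and `F` lies
in the next power. -/
theorem mem_pow_of_le_ordAlong {S R : Type} [CommRing S] [CommRing R] (p : Ideal R) [p.IsPrime]
    (a b : S) (f : S →+* R) (e u : R) (hp : p = Ideal.span {e}) (ha : f a = e) (hb : f b = u * e)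
    (ρ : R →+* Polynomial ℚ) (hρ : p = RingHom.ker ρ) (ε : S → ℚ)
    (hε : ∀ c, ρ (f c) = Polynomial.C (ε c)) (hε0 : ∀ c, ε c = 0 → c ∈ Ideal.span {a, b})
    (hu : ρ u = Polynomial.X) (F : S) (t : ℕ) (h : (t : ℕ∞) ≤ ordAlong p (f F)) :
    F ∈ (Ideal.span {a, b} : Ideal S) ^ t := by
  suffices H : ∀ k ≤ t, F ∈ (Ideal.span {a, b} : Ideal S) ^ k from H t le_rfl
  intro k
  induction k with
  | zero => simp
  | succ k ih =>
    intro hk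
    obtain ⟨c, hc⟩ := exists_form_of_mem_span_pair_pow a b k F (ih (by omega))
    have hfF : f F = e ^ k * ∑ j ∈ Finset.range (k + 1), f (c j) * u ^ j := by
      rw [hc, map_sum, Finset.mul_sum]
      refine Finset.sum_congr rfl fun j hj => ?_
      have hj' := Finset.mem_range.1 hj
      rw [map_mul, map_mul, map_pow, map_pow, ha, hb,
        show e ^ k = e ^ (k - j) * e ^ j by rw [← pow_add]; congr 1; omega]
      ring
    have hs : ∑ j ∈ Finset.range (k + 1), f (c j) * u ^ j ∈ p := by
      by_contra hs
      have := h.trans (hfF ▸ ordAlong_pow_mul_le p e _ hp hs k)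
      have : t ≤ k := by exact_mod_cast this
      omega
    rw [hρ, RingHom.mem_ker, map_sum] at hs
    simp only [map_mul, map_pow, hε, hu] at hs
    rw [hc]
    refine Ideal.sum_mem _ fun j hj => ?_
    -- Compare coefficients of `X ^ j` in the restriction to the divisor.
    have h0 : ε (c j) = 0 := by
      have := congrArg (fun q => Polynomial.coeff q j) hs
      simpa [Polynomial.finsetSum_coeff, Polynomial.coeff_X_pow, Finset.mem_range.1 hj] using this
    rw [pow_succ']
    refine Ideal.mul_mem_mul (hε0 _ h0) ?_
    rw [show (Ideal.span {a, b} : Ideal S) ^ k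
      = Ideal.span {a, b} ^ (k - j) * Ideal.span {a, b} ^ j by
        rw [← pow_add]; congr 1; have := Finset.mem_range.1 hj; omega]
    exact Ideal.mul_mem_mul (Ideal.pow_mem_pow (Ideal.subset_span (by simp)) _)
      (Ideal.pow_mem_pow (Ideal.subset_span (by simp)) _)

open MvPolynomial in
theorem sub_C_aeval_mem (a b : ℚ) (F : MvPolynomial (Fin 2) ℚ) :
    F - C (aeval ![a, b] F) ∈ (Ideal.span {X 0 - C a, X 1 - C b} : Ideal (MvPolynomial (Fin 2) ℚ)) := by
  induction F using MvPolynomial.induction_on with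
  | C r => simp
  | add p q hp hq =>
    rw [map_add, map_add, add_sub_add_comm]
    exact add_mem hp hq
  | mul_X p i hp =>
    have hi : (X i - C ((![a, b] : Fin 2 → ℚ) i) : MvPolynomial (Fin 2) ℚ)
        ∈ (Ideal.span {X 0 - C a, X 1 - C b} : Ideal (MvPolynomial (Fin 2) ℚ)) := by
      fin_cases i <;> exact Ideal.subset_span (by simp)
    rw [map_mul, aeval_X, C_mul, show p * X i - C (aeval ![a, b] p) * C ((![a, b] : Fin 2 → ℚ) i)
      = X i * (p - C (aeval ![a, b] p))
        + C (aeval ![a, b] p) * (X i - C ((![a, b] : Fin 2 → ℚ) i)) by ring]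
    exact add_mem (Ideal.mul_mem_left _ _ hp) (Ideal.mul_mem_left _ _ hi)

open MvPolynomial in
theorem mem_pointIdealP {F : MvPolynomial (Fin 2) ℚ} (h : aeval ![(1 : ℚ), 0] F = 0) :
    F ∈ pointIdealP := by
  have := sub_C_aeval_mem 1 0 F
  rw [h] at this
  simpa [pointIdealP] using this

open MvPolynomial in
theorem mem_pointIdealQ {F : MvPolynomial (Fin 2) ℚ} (h : aeval ![(0 : ℚ), 1] F = 0) :
    F ∈ pointIdealQ := by
  have := sub_C_aeval_mem 0 1 F
  rw [h] at this
  simpa [pointIdealQ, Set.pair_comm] using this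

theorem restrictEP_pullback (F : MvPolynomial (Fin 2) ℚ) :
    restrictEP (pullback F) = Polynomial.C (MvPolynomial.aeval ![(1 : ℚ), 0] F) := by
  have : restrictEP.comp pullback
      = (Algebra.ofId ℚ (Polynomial ℚ)).comp (MvPolynomial.aeval ![(1 : ℚ), 0]) := by
    apply MvPolynomial.algHom_ext
    intro i
    fin_cases i <;> simp [pullback, restrictEP_coord]
  exact DFunLike.congr_fun this F

theorem restrictEQ_pullback (F : MvPolynomial (Fin 2) ℚ) :
    restrictEQ (pullback F) = Polynomial.C (MvPolynomial.aeval ![(0 : ℚ), 1] F) := by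
  have : restrictEQ.comp pullback
      = (Algebra.ofId ℚ (Polynomial ℚ)).comp (MvPolynomial.aeval ![(0 : ℚ), 1]) := by
    apply MvPolynomial.algHom_ext
    intro i
    fin_cases i <;> simp [pullback, restrictEQ_coord]
  exact DFunLike.congr_fun this F

theorem pullback_X (i : Fin 2) :
    pullback (MvPolynomial.X i) = (![coord 0, coord 1] : Fin 2 → BlowUpChart) i :=
  MvPolynomial.aeval_X _ _

theorem span_pair_mul_self {R : Type*} [CommRing R] (e u : R) :
    (Ideal.span {e, u * e} : Ideal R) = Ideal.span {e} := by
  refine le_antisymm (Ideal.span_le.2 ?_) (Ideal.span_mono (by simp))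
  rintro _ (rfl | rfl)
  · exact Ideal.subset_span rfl
  · exact Ideal.mul_mem_left _ _ (Ideal.subset_span rfl)

theorem mem_pow_of_le_ordEP (F : MvPolynomial (Fin 2) ℚ) (t : ℕ) (h : (t : ℕ∞) ≤ ordEP F) :
    F ∈ pointIdealP ^ t := by
  have h0 : pullback (MvPolynomial.X 0 - 1) = coord 0 - 1 := by
    rw [map_sub, map_one, pullback_X]; rfl
  have h1 : pullback (MvPolynomial.X 1) = coord 2 * (coord 0 - 1) := by
    rw [coord_rel₁, pullback_X]; rfl
  refine mem_pow_of_le_ordAlong idealEP _ _ pullback.toRingHom (coord 0 - 1) (coord 2) ?_ h0 h1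
    restrictEP.toRingHom idealEP_eq_ker _ restrictEP_pullback (fun c => mem_pointIdealP)
    (restrictEP_coord 2) F t h
  rw [idealEP, h0, h1, span_pair_mul_self]

theorem mem_pow_of_le_ordEQ (F : MvPolynomial (Fin 2) ℚ) (t : ℕ) (h : (t : ℕ∞) ≤ ordEQ F) :
    F ∈ pointIdealQ ^ t := by
  have h0 : pullback (MvPolynomial.X 1 - 1) = coord 1 - 1 := by
    rw [map_sub, map_one, pullback_X]; rfl
  have h1 : pullback (MvPolynomial.X 0) = coord 3 * (coord 1 - 1) := by
    rw [← coord_rel₂, pullback_X]; rfl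
  refine mem_pow_of_le_ordAlong idealEQ _ _ pullback.toRingHom (coord 1 - 1) (coord 3) ?_ h0 h1
    restrictEQ.toRingHom idealEQ_eq_ker _ restrictEQ_pullback (fun c => mem_pointIdealQ)
    (restrictEQ_coord 3) F t h
  rw [idealEQ, h0, h1]
  exact Ideal.span_pair_comm.trans (span_pair_mul_self _ _)

open MvPolynomial in
theorem isCoprime_pointIdeals : IsCoprime pointIdealP pointIdealQ := by
  rw [Ideal.isCoprime_iff_exists]
  exact ⟨-(X 0 - 1), neg_mem (Ideal.subset_span (by simp)), X 0, Ideal.subset_span (by simp),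
    by ring⟩

theorem mem_pointsIdeal_pow_of_isIntegrableForm {F : MvPolynomial (Fin 2) ℚ} {t : ℕ}
    (h : IsIntegrableForm F t) : F ∈ pointsIdeal ^ t := by
  rw [pointsIdeal, mul_pow, Ideal.mul_eq_inf_of_isCoprime isCoprime_pointIdeals.pow]
  exact ⟨mem_pow_of_le_ordEP F t h.1, mem_pow_of_le_ordEQ F t h.2⟩

open MvPolynomial in
theorem mem_pointsIdeal {F : MvPolynomial (Fin 2) ℚ} (h : aeval ![(1 : ℚ), 0] F = 0)
    (h' : aeval ![(0 : ℚ), 1] F = 0) : F ∈ pointsIdeal := by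
  rw [pointsIdeal, Ideal.mul_eq_inf_of_isCoprime isCoprime_pointIdeals]
  exact ⟨mem_pointIdealP h, mem_pointIdealQ h'⟩

/-! ### Vector fields, the conic and the automorphism -/

open MvPolynomial

/-- The Euler vector field `x ∂/∂x + y ∂/∂y`. -/
def eulerField : Derivation ℚ (MvPolynomial (Fin 2) ℚ) (MvPolynomial (Fin 2) ℚ) :=
  mkDerivation ℚ ![X 0, X 1]

/-- The rotational vector field `x ∂/∂y - y ∂/∂x`. -/
def rotationField : Derivation ℚ (MvPolynomial (Fin 2) ℚ) (MvPolynomial (Fin 2) ℚ) :=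
  mkDerivation ℚ ![-X 1, X 0]

/-- The equation `1 - x² - y²` of the polar locus. -/
def conic : MvPolynomial (Fin 2) ℚ := 1 - X 0 ^ 2 - X 1 ^ 2

/-- Restriction of polynomials to the line `x + y = 1`, with coordinate `y`. -/
def restrictLine : MvPolynomial (Fin 2) ℚ →ₐ[ℚ] Polynomial ℚ :=
  aeval ![1 - Polynomial.X, Polynomial.X]

theorem eulerField_X (i : Fin 2) : eulerField (X i) = X i := by
  rw [eulerField, mkDerivation_X]
  fin_cases i <;> rfl

theorem rotationField_X_zero : rotationField (X 0) = -X 1 := by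
  rw [rotationField, mkDerivation_X]; rfl

theorem rotationField_X_one : rotationField (X 1) = X 0 := by
  rw [rotationField, mkDerivation_X]; rfl

theorem sigma_X_zero : sigma (X 0) = -X 1 := by rw [sigma, aeval_X]; rfl

theorem sigma_X_one : sigma (X 1) = X 0 := by rw [sigma, aeval_X]; rfl

theorem sigma_C (c : ℚ) : sigma (C c) = C c := by rw [sigma, aeval_C]; rfl

theorem derivation_sigma (D : Derivation ℚ (MvPolynomial (Fin 2) ℚ) (MvPolynomial (Fin 2) ℚ))
    (h : ∀ i, D (sigma (X i)) = sigma (D (X i))) (F : MvPolynomial (Fin 2) ℚ) :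
    D (sigma F) = sigma (D F) := by
  induction F using MvPolynomial.induction_on with
  | C r => rw [sigma_C, derivation_C, map_zero]
  | add p q hp hq => simp only [map_add, hp, hq]
  | mul_X p i hp =>
    simp only [map_mul, Derivation.leibniz, smul_eq_mul, map_add, hp, h]

theorem derivation_C_times (D : Derivation ℚ (MvPolynomial (Fin 2) ℚ) (MvPolynomial (Fin 2) ℚ))
    (c : ℚ) (F : MvPolynomial (Fin 2) ℚ) : D (C c * F) = C c * D F := by
  rw [← smul_eq_C_mul, ← smul_eq_C_mul, Derivation.map_smul]

theorem eulerField_sigma (F : MvPolynomial (Fin 2) ℚ) :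
    eulerField (sigma F) = sigma (eulerField F) := by
  refine derivation_sigma _ (fun i => ?_) F
  fin_cases i <;> simp [sigma_X_zero, sigma_X_one, eulerField_X]

theorem rotationField_sigma (F : MvPolynomial (Fin 2) ℚ) :
    rotationField (sigma F) = sigma (rotationField F) := by
  refine derivation_sigma _ (fun i => ?_) F
  fin_cases i <;>
    simp [sigma_X_zero, sigma_X_one, rotationField_X_zero, rotationField_X_one]

theorem sigma_conic : sigma conic = conic := by
  simp only [conic, map_sub, map_one, map_pow, sigma_X_zero, sigma_X_one]
  ring

theorem sigma_sigma_sigma_sigma (F : MvPolynomial (Fin 2) ℚ) :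
    sigma (sigma (sigma (sigma F))) = F := by
  induction F using MvPolynomial.induction_on with
  | C r => simp only [sigma_C]
  | add p q hp hq => simp only [map_add, hp, hq]
  | mul_X p i hp =>
    simp only [map_mul, hp]
    fin_cases i <;> simp [sigma_X_zero, sigma_X_one]

/-- By the Leibniz rule each term differentiates only one factor, so a single power of `I` is lost.
-/
theorem derivation_mem_pow {A : Type*} [CommRing A] [Algebra ℚ A] (D : Derivation ℚ A A)
    (I : Ideal A) (n : ℕ) : ∀ F ∈ I ^ (n + 1), D F ∈ I ^ n := by
  induction n with
  | zero => simp
  | succ n ih =>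
    intro F hF
    rw [pow_succ'] at hF
    refine Submodule.mul_induction_on hF (fun a ha b hb => ?_) (fun a b ha hb => ?_)
    · rw [Derivation.leibniz, smul_eq_mul, smul_eq_mul]
      refine add_mem ?_ (Ideal.mul_mem_right _ _ hb)
      rw [pow_succ']
      exact Ideal.mul_mem_mul ha (ih b hb)
    · rw [map_add]
      exact add_mem ha hb

theorem conic_mem_pointsIdeal : conic ∈ pointsIdeal := by
  apply mem_pointsIdeal <;> simp [conic]

theorem bivariate_induction {p : MvPolynomial (Fin 2) ℚ → Prop}
    (hadd : ∀ F G, p F → p G → p (F + G)) (hC : ∀ c F, p F → p (C c * F))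
    (hmon : ∀ a b, p (X 0 ^ a * X 1 ^ b)) (F : MvPolynomial (Fin 2) ℚ) : p F := by
  induction F using MvPolynomial.induction_on' with
  | monomial u a =>
    rw [monomial_eq, Finsupp.prod_fintype _ _ (by simp), Fin.prod_univ_two]
    exact hC _ _ (hmon _ _)
  | add F G hF hG => exact hadd _ _ hF hG

/-- The line passes through both points, so the two point ideals restrict into the ideals of `y` and
`1 - y`. This is what cancels the poles of the boundary terms. -/
theorem exists_restrictLine_eq {F : MvPolynomial (Fin 2) ℚ} {n : ℕ} (hF : F ∈ pointsIdeal ^ n) :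
    ∃ p : Polynomial ℚ, restrictLine F = (Polynomial.X * (1 - Polynomial.X)) ^ n * p := by
  have hP : pointIdealP.map restrictLine ≤ Ideal.span {Polynomial.X} := by
    rw [pointIdealP, Ideal.map_span, Ideal.span_le]
    rintro _ ⟨_, rfl | rfl, rfl⟩
    · simp [restrictLine]
    · simp [restrictLine]
  have hQ : pointIdealQ.map restrictLine ≤ Ideal.span {1 - Polynomial.X} := by
    rw [pointIdealQ, Ideal.map_span, Ideal.span_le]
    rintro _ ⟨_, rfl | rfl, rfl⟩
    · simp only [restrictLine, map_sub, map_one, aeval_X, SetLike.mem_coe,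
        Ideal.mem_span_singleton]
      exact ⟨-1, by simp⟩
    · simp [restrictLine]
  have h := Ideal.mem_map_of_mem restrictLine hF
  rw [Ideal.map_pow, pointsIdeal, Ideal.map_mul] at h
  have h2 := Ideal.pow_right_mono (Ideal.mul_mono hP hQ) n h
  rw [Ideal.span_singleton_mul_span_singleton, Ideal.span_singleton_pow,
    Ideal.mem_span_singleton] at h2
  exact h2

/-- `E + 2` is diagonal on monomials, with eigenvalue `a + b + 2 ≠ 0` on `x ^ a y ^ b`. In the plane
`E H + 2 H` is the divergence of `H E`. -/
theorem exists_eulerField_add_two_mul (A : MvPolynomial (Fin 2) ℚ) :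
    ∃ H, A = eulerField H + 2 * H := by
  refine bivariate_induction (p := fun A => ∃ H, A = eulerField H + 2 * H) ?_ ?_ ?_ A
  · rintro _ _ ⟨H, rfl⟩ ⟨H', rfl⟩
    exact ⟨H + H', by rw [map_add]; ring⟩
  · rintro c _ ⟨H, rfl⟩
    exact ⟨C c * H, by rw [derivation_C_times]; ring⟩
  · intro a b
    have key : eulerField (X 0 ^ a * X 1 ^ b) = C ((a : ℚ) + b) * (X 0 ^ a * X 1 ^ b) := by
      rw [Derivation.leibniz, Derivation.leibniz_pow, Derivation.leibniz_pow, eulerField_X,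
        eulerField_X]
      rcases a with _ | a <;> rcases b with _ | b <;>
        simp [pow_succ] <;> ring
    have h : C ((a : ℚ) + b + 2)⁻¹ * C ((a : ℚ) + b + 2) = (1 : MvPolynomial (Fin 2) ℚ) := by
      rw [← C_mul, inv_mul_cancel₀ (by positivity), C_1]
    refine ⟨C ((a : ℚ) + b + 2)⁻¹ * (X 0 ^ a * X 1 ^ b), ?_⟩
    rw [derivation_C_times, key]
    have h2 : (C ((a : ℚ) + b + 2) : MvPolynomial (Fin 2) ℚ) = C ((a : ℚ) + b) + 2 := by
      rw [C_add]; rfl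
    rw [h2] at h
    linear_combination (-(X 0 ^ a * X 1 ^ b)) * h

/-! ### Decomposition modulo the conic and rotational derivatives -/

/-- The polynomials which modulo the conic are the sum of a constant and a rotational derivative. -/
def IsCircleExact (F : MvPolynomial (Fin 2) ℚ) : Prop :=
  ∃ (c : ℚ) (A H : MvPolynomial (Fin 2) ℚ), F = C c + conic * A + rotationField H

namespace IsCircleExact

theorem add {F G : MvPolynomial (Fin 2) ℚ} (hF : IsCircleExact F) (hG : IsCircleExact G) :
    IsCircleExact (F + G) := by
  obtain ⟨c, A, H, rfl⟩ := hF
  obtain ⟨c', A', H', rfl⟩ := hG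
  exact ⟨c + c', A + A', H + H', by simp only [map_add]; ring⟩

theorem C_mul {F : MvPolynomial (Fin 2) ℚ} (r : ℚ) (hF : IsCircleExact F) :
    IsCircleExact (C r * F) := by
  obtain ⟨c, A, H, rfl⟩ := hF
  exact ⟨r * c, C r * A, C r * H, by
    rw [derivation_C_times, MvPolynomial.C_mul]; ring⟩

theorem conic_mul (F : MvPolynomial (Fin 2) ℚ) : IsCircleExact (conic * F) :=
  ⟨0, F, 0, by simp⟩

theorem rotationField (F : MvPolynomial (Fin 2) ℚ) : IsCircleExact (rotationField F) :=
  ⟨0, 0, F, by simp⟩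

theorem X_one_pow (b : ℕ) : IsCircleExact (X 1 ^ b) := by
  induction b using Nat.twoStepInduction with
  | zero => exact ⟨1, 0, 0, by simp⟩
  | one => exact ⟨0, 0, -X 0, by simp [rotationField_X_zero]⟩
  | more b ih _ =>
    have h2 : (C ((b : ℚ) + 2) : MvPolynomial (Fin 2) ℚ) = C ((b : ℚ) + 1) + 1 := by
      rw [← C_1, ← C_add]; congr 1; ring
    have h : C ((b : ℚ) + 2)⁻¹ * C ((b : ℚ) + 2) = (1 : MvPolynomial (Fin 2) ℚ) := by
      rw [← MvPolynomial.C_mul, inv_mul_cancel₀ (by positivity), C_1]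
    have key : CatalanForms.rotationField (-(X 0 * X 1 ^ (b + 1)))
        = X 1 ^ (b + 2) - C ((b : ℚ) + 1) * (X 0 ^ 2 * X 1 ^ b) := by
      rw [map_neg, Derivation.leibniz, Derivation.leibniz_pow, rotationField_X_zero,
        rotationField_X_one]
      simp
      ring
    -- Substituting `x² = 1 - y² - g` in `key` gives `(b + 2) y ^ (b + 2) = (b + 1) y ^ b - (b + 1)
    -- g y ^ b + R (-x y ^ (b + 1))`.
    have := (((C_mul ((b : ℚ) + 1) ih).add (conic_mul (-C ((b : ℚ) + 1) * X 1 ^ b))).add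
      (rotationField (-(X 0 * X 1 ^ (b + 1))))).C_mul ((b : ℚ) + 2)⁻¹
    convert this using 1
    rw [key]
    rw [h2] at h
    rw [conic]
    linear_combination (-(X 1 ^ (b + 2))) * h

theorem X_zero_mul_X_one_pow (b : ℕ) : IsCircleExact (X 0 * X 1 ^ b) := by
  have h : C ((b : ℚ) + 1)⁻¹ * C ((b : ℚ) + 1) = (1 : MvPolynomial (Fin 2) ℚ) := by
    rw [← MvPolynomial.C_mul, inv_mul_cancel₀ (by positivity), C_1]
  have key : CatalanForms.rotationField (X 1 ^ (b + 1)) = C ((b : ℚ) + 1) * (X 0 * X 1 ^ b) := by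
    rw [Derivation.leibniz_pow, rotationField_X_one, nsmul_eq_mul, smul_eq_mul,
      show C ((b : ℚ) + 1) = ((b + 1 : ℕ) : MvPolynomial (Fin 2) ℚ) by simp, Nat.add_sub_cancel]
    ring
  convert (rotationField (X 1 ^ (b + 1))).C_mul ((b : ℚ) + 1)⁻¹ using 1
  rw [key]
  linear_combination (-(X 0 * X 1 ^ b)) * h

theorem of_monomial (a : ℕ) : ∀ b : ℕ, IsCircleExact (X 0 ^ a * X 1 ^ b) := by
  induction a using Nat.twoStepInduction with
  | zero => simpa using X_one_pow
  | one => simpa using X_zero_mul_X_one_pow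
  | more a ih _ =>
    intro b
    -- The relation `x² = 1 - y² - g` lowers the exponent of `x` by two.
    convert ((ih b).add ((ih (b + 2)).C_mul (-1))).add (conic_mul (-(X 0 ^ a * X 1 ^ b))) using 1
    simp only [conic, C_neg, C_1]
    ring

end IsCircleExact

theorem isCircleExact (F : MvPolynomial (Fin 2) ℚ) : IsCircleExact F :=
  bivariate_induction (fun _ _ => IsCircleExact.add) (fun c _ => IsCircleExact.C_mul c)
    IsCircleExact.of_monomial F

/-- Average the decomposition over the cyclic group of order four generated by `σ`, which fixes the
conic and commutes with `R`. The averaged primitive takes equal values at the two points, which `σ`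
links, so one constant, killed by `R`, can be subtracted to make it vanish at both. -/
theorem exists_sigma_invariant_primitive {F : MvPolynomial (Fin 2) ℚ} (hF : sigma F = F) :
    ∃ (c : ℚ) (A H : MvPolynomial (Fin 2) ℚ), F = C c + conic * A + rotationField H ∧
      sigma H = H ∧ H ∈ pointsIdeal := by
  obtain ⟨c, A, H, h⟩ := isCircleExact F
  let avg : MvPolynomial (Fin 2) ℚ → MvPolynomial (Fin 2) ℚ := fun G =>
    C (1 / 4) * (G + sigma G + sigma (sigma G) + sigma (sigma (sigma G)))
  have hs : ∀ G, sigma (avg G) = avg G := by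
    intro G
    simp only [avg, map_mul, map_add, sigma_C, sigma_sigma_sigma_sigma]
    ring
  have hQ : aeval ![(0 : ℚ), 1] (avg H) = aeval ![(1 : ℚ), 0] (avg H) := by
    have : (aeval ![(1 : ℚ), 0]).comp sigma = aeval ![(0 : ℚ), 1] := by
      apply MvPolynomial.algHom_ext
      intro i
      fin_cases i <;> simp [sigma]
    rw [← this, AlgHom.comp_apply, hs]
  refine ⟨c, avg A, avg H - C (aeval ![(1 : ℚ), 0] (avg H)), ?_, ?_, ?_⟩
  · have h4 : C (1 / 4) * 4 = (1 : MvPolynomial (Fin 2) ℚ) := by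
      rw [show (4 : MvPolynomial (Fin 2) ℚ) = C 4 from rfl, ← C_mul]; norm_num
    have h1 := congrArg sigma h
    have h2 := congrArg sigma h1
    have h3 := congrArg sigma h2
    simp only [map_add, map_mul, sigma_C, sigma_conic, ← rotationField_sigma, hF] at h1 h2 h3
    simp only [map_sub, derivation_C, derivation_C_times, avg, map_add]
    linear_combination C (1 / 4) * (h + h1 + h2 + h3) + (C c - F) * h4
  · rw [map_sub, hs, sigma_C]
  · apply mem_pointsIdeal
    · simp
    · rw [map_sub, hQ]; simp

theorem sigma_poleReduction {F : MvPolynomial (Fin 2) ℚ} (hF : sigma F = F) (c : ℚ) :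
    sigma (F - C c * (eulerField F + 2 * F)) = F - C c * (eulerField F + 2 * F) := by
  have : sigma (2 : MvPolynomial (Fin 2) ℚ) = 2 := map_ofNat _ 2
  rw [map_sub, map_mul, map_add, map_mul, sigma_C, ← eulerField_sigma, hF, this]

/-! ### Cone coordinates on the simplex -/

open MvPolynomial Set

/-- Coordinates on the simplex adapted to its vertex at the origin: the first coordinate is `x + y`,
the second one the position on the segment between the two axes. -/
def coneMap (p : ℝ × ℝ) : ℝ × ℝ := (p.1 * (1 - p.2), p.1 * p.2)

/-- The open unit square. -/
def unitSquare : Set (ℝ × ℝ) := Ioo 0 1 ×ˢ Ioo 0 1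

theorem hasFDerivAt_coneMap (p : ℝ × ℝ) :
    HasFDerivAt coneMap (LinearMap.toContinuousLinearMap (Matrix.toLin (Module.Basis.finTwoProd ℝ)
      (Module.Basis.finTwoProd ℝ) !![1 - p.2, -p.1; p.2, p.1])) p := by
  rw [Matrix.toLin_finTwoProd_toContinuousLinearMap]
  have h1 : HasFDerivAt (fun q : ℝ × ℝ => q.1) (ContinuousLinearMap.fst ℝ ℝ ℝ) p := hasFDerivAt_fst
  have h2 : HasFDerivAt (fun q : ℝ × ℝ => q.2) (ContinuousLinearMap.snd ℝ ℝ ℝ) p := hasFDerivAt_snd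
  refine ((h1.fun_mul (h2.const_sub 1)).prodMk (h1.fun_mul h2)).congr_fderiv ?_
  ext <;> simp

theorem injOn_coneMap : InjOn coneMap (Ioc 0 1 ×ˢ Icc 0 1) := by
  rintro ⟨a, b⟩ ⟨⟨ha, -⟩, -⟩ ⟨c, d⟩ - h
  simp only [coneMap, Prod.mk.injEq] at h
  simp only at ha
  obtain ⟨h1, h2⟩ := h
  have hac : a = c := by linarith
  subst hac
  rw [mul_right_inj' ha.ne'] at h2
  rw [h2]

/-- The side `p.1 = 0`, which collapses to the origin, is left out so that the chart is injective;
this costs only a null set. -/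
theorem image_coneMap : coneMap '' (Ioc 0 1 ×ˢ Icc 0 1) = simplex \ {0} := by
  ext ⟨x, y⟩
  constructor
  · rintro ⟨⟨a, b⟩, ⟨⟨ha, ha'⟩, hb, hb'⟩, h⟩
    simp only [coneMap, Prod.mk.injEq] at h ha ha' hb hb'
    obtain ⟨rfl, rfl⟩ := h
    refine ⟨⟨mul_nonneg ha.le (by linarith), mul_nonneg ha.le hb, ?_⟩, ?_⟩
    · simp only; linarith
    · intro h0
      simp only [mem_singleton_iff, Prod.mk_eq_zero] at h0
      linarith [h0.1, h0.2]
  · rintro ⟨⟨hx, hy, hxy⟩, h0⟩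
    simp only [mem_singleton_iff, Prod.mk_eq_zero] at h0 hx hy hxy
    have hpos : 0 < x + y := by
      rcases hx.eq_or_lt with h | h
      · rcases hy.eq_or_lt with h' | h'
        · exact absurd ⟨h.symm, h'.symm⟩ h0
        · linarith
      · linarith
    refine ⟨(x + y, y / (x + y)), ⟨⟨hpos, ?_⟩, ?_, ?_⟩, ?_⟩
    · simp only; linarith
    · simp only; positivity
    · simp only; rw [div_le_one hpos]; linarith
    · simp only [coneMap, Prod.mk.injEq]
      constructor <;> field_simp
      ring

theorem unitSquare_ae_eq :
    (Ioc 0 1 ×ˢ Icc 0 1 : Set (ℝ × ℝ)) =ᵐ[volume] unitSquare :=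
  Measure.set_prod_ae_eq Ioo_ae_eq_Ioc.symm Ioo_ae_eq_Icc.symm

theorem simplex_diff_ae_eq : (simplex \ {0} : Set (ℝ × ℝ)) =ᵐ[volume] simplex :=
  sdiff_null_ae_eq_self (measure_singleton _)

theorem abs_det_coneMap {p : ℝ × ℝ} (hp : p ∈ (Ioc 0 1 ×ˢ Icc 0 1 : Set (ℝ × ℝ))) :
    |(LinearMap.toContinuousLinearMap (Matrix.toLin (Module.Basis.finTwoProd ℝ)
      (Module.Basis.finTwoProd ℝ) !![1 - p.2, -p.1; p.2, p.1])).det| = p.1 := by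
  rw [LinearMap.det_toContinuousLinearMap, LinearMap.det_toLin, Matrix.det_fin_two_of]
  rw [show (1 - p.2) * p.1 - -p.1 * p.2 = p.1 by ring, abs_of_pos hp.1.1]

theorem integrableOn_simplex_iff (f : ℝ × ℝ → ℝ) :
    IntegrableOn f simplex ↔ IntegrableOn (fun p => p.1 * f (coneMap p)) unitSquare := by
  have hS : MeasurableSet (Ioc 0 1 ×ˢ Icc 0 1 : Set (ℝ × ℝ)) :=
    measurableSet_Ioc.prod measurableSet_Icc
  rw [← integrableOn_congr_set_ae simplex_diff_ae_eq, ← image_coneMap,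
    integrableOn_image_iff_integrableOn_abs_det_fderiv_smul volume hS
      (fun p _ => (hasFDerivAt_coneMap p).hasFDerivWithinAt) injOn_coneMap,
    ← integrableOn_congr_set_ae unitSquare_ae_eq]
  refine integrableOn_congr_fun (fun p hp => ?_) hS
  simp only [abs_det_coneMap hp, smul_eq_mul]

theorem setIntegral_simplex (f : ℝ × ℝ → ℝ) :
    ∫ p in simplex, f p = ∫ p in unitSquare, p.1 * f (coneMap p) := by
  have hS : MeasurableSet (Ioc 0 1 ×ˢ Icc 0 1 : Set (ℝ × ℝ)) :=
    measurableSet_Ioc.prod measurableSet_Icc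
  rw [← setIntegral_congr_set simplex_diff_ae_eq, ← image_coneMap,
    integral_image_eq_integral_abs_det_fderiv_smul volume hS
      (fun p _ => (hasFDerivAt_coneMap p).hasFDerivWithinAt) injOn_coneMap,
    ← setIntegral_congr_set unitSquare_ae_eq]
  refine setIntegral_congr_fun hS (fun p hp => ?_)
  simp only [abs_det_coneMap hp, smul_eq_mul]

/-! ### Bounds on the simplex and absolute convergence -/

/-- The value of a polynomial with rational coefficients at a real point. -/
def value (F : MvPolynomial (Fin 2) ℚ) (p : ℝ × ℝ) : ℝ := aeval ![p.1, p.2] F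

theorem value_add (F G : MvPolynomial (Fin 2) ℚ) (p : ℝ × ℝ) :
    value (F + G) p = value F p + value G p := map_add _ _ _

theorem value_sub (F G : MvPolynomial (Fin 2) ℚ) (p : ℝ × ℝ) :
    value (F - G) p = value F p - value G p := map_sub _ _ _

theorem value_mul (F G : MvPolynomial (Fin 2) ℚ) (p : ℝ × ℝ) :
    value (F * G) p = value F p * value G p := map_mul _ _ _

theorem value_pow (F : MvPolynomial (Fin 2) ℚ) (n : ℕ) (p : ℝ × ℝ) :
    value (F ^ n) p = value F p ^ n := map_pow _ _ _

theorem value_C (c : ℚ) (p : ℝ × ℝ) : value (C c) p = c := by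
  simp [value]

theorem value_two (p : ℝ × ℝ) : value 2 p = 2 := map_ofNat _ 2

theorem value_one (p : ℝ × ℝ) : value 1 p = 1 := map_one _

theorem value_X_zero (p : ℝ × ℝ) : value (X 0) p = p.1 := by simp [value]

theorem value_X_one (p : ℝ × ℝ) : value (X 1) p = p.2 := by simp [value]

theorem value_conic (p : ℝ × ℝ) : value conic p = 1 - p.1 ^ 2 - p.2 ^ 2 := by
  simp [value, conic]

theorem value_conic_coneMap (p : ℝ × ℝ) :
    value conic (coneMap p) = 1 - p.1 ^ 2 * (1 - 2 * p.2 + 2 * p.2 ^ 2) := by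
  simp only [value_conic, coneMap]
  ring

theorem density_eq (F : MvPolynomial (Fin 2) ℚ) (t : ℕ) (p : ℝ × ℝ) :
    density F t p = value F p / value conic p ^ (t + 1) := by
  rw [value_conic]; rfl

theorem continuous_value (F : MvPolynomial (Fin 2) ℚ) : Continuous (value F) := by
  refine bivariate_induction (p := fun F => Continuous (value F)) ?_ ?_ ?_ F
  · intro F G hF hG
    exact (hF.add hG).congr fun p => (value_add F G p).symm
  · intro c F hF
    exact (hF.const_mul (c : ℝ)).congr fun p => by rw [value_mul, value_C]
  · intro a b
    have : Continuous fun p : ℝ × ℝ => p.1 ^ a * p.2 ^ b := by fun_prop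
    exact this.congr fun p => by rw [value_mul, value_pow, value_pow, value_X_zero, value_X_one]

theorem continuous_coneMap : Continuous coneMap := by
  unfold coneMap
  fun_prop

theorem coneMap_mem_simplex {p : ℝ × ℝ} (hp : p ∈ unitSquare) : coneMap p ∈ simplex := by
  obtain ⟨⟨h1, h2⟩, h3, h4⟩ := hp
  refine ⟨mul_nonneg h1.le (by linarith), mul_nonneg h1.le h3.le, ?_⟩
  simp only [coneMap]
  linarith

theorem one_sub_fst_le_conic {p : ℝ × ℝ} (h1 : p.1 ∈ Icc 0 1) (h2 : p.2 ∈ Icc 0 1) :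
    1 - p.1 ≤ value conic (coneMap p) := by
  rw [value_conic_coneMap]
  obtain ⟨a, b⟩ := p
  simp only [mem_Icc] at *
  have : 0 ≤ b * (1 - b) := mul_nonneg h2.1 (by linarith)
  have : 0 ≤ a * (1 - a) := mul_nonneg h1.1 (by linarith)
  nlinarith [sq_nonneg a]

theorem mul_one_sub_snd_le_conic {p : ℝ × ℝ} (h1 : p.1 ∈ Icc 0 1) (h2 : p.2 ∈ Icc 0 1) :
    2 * (p.2 * (1 - p.2)) ≤ value conic (coneMap p) := by
  rw [value_conic_coneMap]
  obtain ⟨a, b⟩ := p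
  simp only [mem_Icc] at *
  have ha : a ^ 2 ≤ 1 := by nlinarith
  have hq : 0 ≤ 1 - 2 * b + 2 * b ^ 2 := by nlinarith [sq_nonneg (1 - b), sq_nonneg b]
  nlinarith [mul_le_mul_of_nonneg_right ha hq]

theorem conic_pos_of_fst_lt {p : ℝ × ℝ} (h1 : p.1 ∈ Ioo 0 1) (h2 : p.2 ∈ Icc 0 1) :
    0 < value conic (coneMap p) :=
  (sub_pos.2 h1.2).trans_le (one_sub_fst_le_conic (Ioo_subset_Icc_self h1) h2)

theorem conic_pos_of_snd_mem {p : ℝ × ℝ} (h1 : p.1 ∈ Icc 0 1) (h2 : p.2 ∈ Ioo 0 1) :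
    0 < value conic (coneMap p) := by
  refine lt_of_lt_of_le ?_ (mul_one_sub_snd_le_conic h1 (Ioo_subset_Icc_self h2))
  have := mul_pos h2.1 (sub_pos.2 h2.2)
  linarith

theorem exists_abs_value_le (F : MvPolynomial (Fin 2) ℚ) :
    ∃ M : ℝ, 0 ≤ M ∧ ∀ p ∈ simplex, |value F p| ≤ M := by
  obtain ⟨M, hM⟩ := (isCompact_Icc (a := ((0 : ℝ), (0 : ℝ))) (b := (1, 1))).exists_bound_of_continuousOn
    (continuous_value F).continuousOn
  refine ⟨|M|, abs_nonneg M, fun p hp => (hM p ?_).trans (le_abs_self M)⟩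
  obtain ⟨h1, h2, h3⟩ := hp
  exact ⟨⟨h1, h2⟩, ⟨by simp only; linarith, by simp only; linarith⟩⟩

theorem conic_nonneg {p : ℝ × ℝ} (hp : p ∈ simplex) : 0 ≤ value conic p := by
  obtain ⟨h1, h2, h3⟩ := hp
  rw [value_conic]
  nlinarith [mul_nonneg h1 h2]

/-- Elements of the two point ideals are bounded by multiples of `1 - x + y` and `1 - y + x`, whose
product is `1 - (x - y)² = g + 2xy`. On the simplex `2xy ≤ g`, because `(x + y)² ≤ 1`. -/
theorem exists_abs_value_le_conic {F : MvPolynomial (Fin 2) ℚ} (hF : F ∈ pointsIdeal) :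
    ∃ M : ℝ, 0 ≤ M ∧ ∀ p ∈ simplex, |value F p| ≤ M * value conic p := by
  refine Submodule.mul_induction_on hF ?_ ?_
  · intro a ha b hb
    obtain ⟨a1, a2, rfl⟩ := Ideal.mem_span_pair.1 ha
    obtain ⟨b1, b2, rfl⟩ := Ideal.mem_span_pair.1 hb
    obtain ⟨A1, hA1, h1⟩ := exists_abs_value_le a1
    obtain ⟨A2, hA2, h2⟩ := exists_abs_value_le a2
    obtain ⟨B1, hB1, h3⟩ := exists_abs_value_le b1
    obtain ⟨B2, hB2, h4⟩ := exists_abs_value_le b2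
    refine ⟨2 * ((A1 + A2) * (B1 + B2)), by positivity, fun p hp => ?_⟩
    have hA : |value (a1 * (X 0 - 1) + a2 * X 1) p| ≤ (A1 + A2) * ((1 - p.1) + p.2) := by
      rw [value_add, value_mul, value_mul, value_sub, value_X_zero, value_X_one, value_one]
      refine (abs_add_le _ _).trans ?_
      rw [abs_mul, abs_mul, abs_of_nonneg hp.2.1, abs_of_nonpos (a := p.1 - 1) (by linarith [hp.2.1, hp.2.2])]
      have hx : 0 ≤ 1 - p.1 := by linarith [hp.2.1, hp.2.2]
      nlinarith [mul_le_mul_of_nonneg_right (h1 p hp) hx,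
        mul_le_mul_of_nonneg_right (h2 p hp) hp.2.1, mul_nonneg hA1 hp.2.1, mul_nonneg hA2 hx]
    have hB : |value (b1 * (X 1 - 1) + b2 * X 0) p| ≤ (B1 + B2) * ((1 - p.2) + p.1) := by
      rw [value_add, value_mul, value_mul, value_sub, value_X_zero, value_X_one, value_one]
      refine (abs_add_le _ _).trans ?_
      rw [abs_mul, abs_mul, abs_of_nonneg hp.1, abs_of_nonpos (a := p.2 - 1) (by linarith [hp.1, hp.2.2])]
      have hx : 0 ≤ 1 - p.2 := by linarith [hp.1, hp.2.2]
      nlinarith [mul_le_mul_of_nonneg_right (h3 p hp) hx,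
        mul_le_mul_of_nonneg_right (h4 p hp) hp.1, mul_nonneg hB1 hp.1, mul_nonneg hB2 hx]
    rw [value_mul, abs_mul]
    refine (mul_le_mul hA hB (abs_nonneg _) ((abs_nonneg _).trans hA)).trans ?_
    have key : ((1 - p.1) + p.2) * ((1 - p.2) + p.1) ≤ 2 * value conic p := by
      obtain ⟨h1, h2, h3⟩ := hp
      rw [value_conic]
      nlinarith [mul_nonneg h1 h2]
    calc _ = (A1 + A2) * (B1 + B2) * (((1 - p.1) + p.2) * ((1 - p.2) + p.1)) := by ring
      _ ≤ (A1 + A2) * (B1 + B2) * (2 * value conic p) := by gcongr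
      _ = _ := by ring
  · rintro F G ⟨M, hM, h⟩ ⟨M', hM', h'⟩
    refine ⟨M + M', by positivity, fun p hp => ?_⟩
    rw [value_add, add_mul]
    exact (abs_add_le _ _).trans (add_le_add (h p hp) (h' p hp))

theorem exists_abs_value_le_conic_pow (n : ℕ) :
    ∀ F ∈ pointsIdeal ^ n, ∃ M : ℝ, 0 ≤ M ∧ ∀ p ∈ simplex, |value F p| ≤ M * value conic p ^ n := by
  induction n with
  | zero => intro F _; simpa using exists_abs_value_le F
  | succ n ih =>
    intro F hF
    rw [pow_succ'] at hF
    refine Submodule.mul_induction_on hF ?_ ?_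
    · intro a ha b hb
      obtain ⟨M, hM, h⟩ := exists_abs_value_le_conic ha
      obtain ⟨M', hM', h'⟩ := ih b hb
      refine ⟨M * M', by positivity, fun p hp => ?_⟩
      rw [value_mul, abs_mul]
      refine (mul_le_mul (h p hp) (h' p hp) (abs_nonneg _)
        (mul_nonneg hM (conic_nonneg hp))).trans (le_of_eq ?_)
      ring
    · rintro F G ⟨M, hM, h⟩ ⟨M', hM', h'⟩
      refine ⟨M + M', by positivity, fun p hp => ?_⟩
      rw [value_add, add_mul]
      exact (abs_add_le _ _).trans (add_le_add (h p hp) (h' p hp))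

theorem integrableOn_rpow : IntegrableOn (fun y : ℝ => y ^ (-(1 / 2) : ℝ)) (Ioo 0 1) := by
  have := intervalIntegral.intervalIntegrable_rpow' (a := 0) (b := 1) (r := -(1 / 2)) (by norm_num)
  rwa [intervalIntegrable_iff_integrableOn_Ioo_of_le zero_le_one] at this

theorem integrableOn_one_sub_rpow :
    IntegrableOn (fun y : ℝ => (1 - y) ^ (-(1 / 2) : ℝ)) (Ioo 0 1) := by
  have := (intervalIntegral.intervalIntegrable_rpow' (a := 0) (b := 1) (r := -(1 / 2))
    (by norm_num)).comp_sub_left 1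
  rw [sub_zero, sub_self] at this
  have := this.symm
  rwa [intervalIntegrable_iff_integrableOn_Ioo_of_le zero_le_one] at this

theorem rpow_neg_half_sq {y : ℝ} (hy : 0 < y) : (y ^ (-(1 / 2) : ℝ)) ^ 2 * y = 1 := by
  rw [← Real.rpow_natCast, ← Real.rpow_mul hy.le]
  norm_num
  rw [Real.rpow_neg_one, inv_mul_cancel₀ hy.ne']

/-- Take the geometric mean of the bounds `g ≥ 1 - l` and `g ≥ y (1 - y)`, using `1 / (y (1 - y)) =
1 / y + 1 / (1 - y)`. It yields a product majorant of `1 / g` with integrable inverse square-root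
singularities. -/
theorem one_le_conic_mul {p : ℝ × ℝ} (hp : p ∈ unitSquare) :
    1 ≤ value conic (coneMap p) *
      ((1 - p.1) ^ (-(1 / 2) : ℝ) * (p.2 ^ (-(1 / 2) : ℝ) + (1 - p.2) ^ (-(1 / 2) : ℝ))) := by
  have h1 := one_sub_fst_le_conic (Ioo_subset_Icc_self hp.1) (Ioo_subset_Icc_self hp.2)
  have h2 := mul_one_sub_snd_le_conic (Ioo_subset_Icc_self hp.1) (Ioo_subset_Icc_self hp.2)
  obtain ⟨⟨hl0, hl1⟩, hy0, hy1⟩ := hp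
  set g := value conic (coneMap p)
  have hl : 0 < 1 - p.1 := by linarith
  have hy : 0 < 1 - p.2 := by linarith
  have ea := rpow_neg_half_sq hl
  have eb := rpow_neg_half_sq hy0
  have ec := rpow_neg_half_sq hy
  have pa := Real.rpow_pos_of_pos hl (-(1 / 2))
  have pb := Real.rpow_pos_of_pos hy0 (-(1 / 2))
  have pc := Real.rpow_pos_of_pos hy (-(1 / 2))
  set a := (1 - p.1) ^ (-(1 / 2) : ℝ)
  set b := p.2 ^ (-(1 / 2) : ℝ)
  set c := (1 - p.2) ^ (-(1 / 2) : ℝ)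
  have hg : 0 < g := by linarith
  have hbc : (b ^ 2 + c ^ 2) * (p.2 * (1 - p.2)) = 1 := by
    linear_combination (1 - p.2) * eb + p.2 * ec
  refine one_le_pow_iff_of_nonneg (by positivity) two_ne_zero |>.1 ?_
  calc (1 : ℝ) = (a ^ 2 * (1 - p.1)) * ((b ^ 2 + c ^ 2) * (p.2 * (1 - p.2))) := by
        rw [ea, hbc, one_mul]
    _ ≤ (a ^ 2 * g) * ((b ^ 2 + c ^ 2) * g) := by
        have : p.2 * (1 - p.2) ≤ g := by nlinarith
        gcongr
    _ ≤ (a ^ 2 * g) * ((b + c) ^ 2 * g) := by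
        have : b ^ 2 + c ^ 2 ≤ (b + c) ^ 2 := by nlinarith
        gcongr
    _ = _ := by ring

theorem measurable_density (F : MvPolynomial (Fin 2) ℚ) (t : ℕ) : Measurable (density F t) := by
  have : density F t = fun p => value F p / value conic p ^ (t + 1) := funext (density_eq F t)
  rw [this]
  exact (continuous_value F).measurable.div ((continuous_value conic).measurable.pow_const _)

theorem measurableSet_unitSquare : MeasurableSet unitSquare :=
  measurableSet_Ioo.prod measurableSet_Ioo

theorem volume_restrict_unitSquare : (volume : Measure (ℝ × ℝ)).restrict unitSquare
    = (volume.restrict (Ioo 0 1)).prod (volume.restrict (Ioo 0 1)) := by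
  rw [Measure.prod_restrict]; rfl

theorem integrableOn_density {F : MvPolynomial (Fin 2) ℚ} {t : ℕ} (hF : F ∈ pointsIdeal ^ t) :
    IntegrableOn (fun p => p.1 * density F t (coneMap p)) unitSquare := by
  obtain ⟨M, hM, h⟩ := exists_abs_value_le_conic_pow t F hF
  have hdom : IntegrableOn (fun p : ℝ × ℝ => M * ((1 - p.1) ^ (-(1 / 2) : ℝ) *
      (p.2 ^ (-(1 / 2) : ℝ) + (1 - p.2) ^ (-(1 / 2) : ℝ)))) unitSquare := by
    refine Integrable.const_mul ?_ M
    rw [volume_restrict_unitSquare]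
    exact Integrable.mul_prod integrableOn_one_sub_rpow
      (integrableOn_rpow.add integrableOn_one_sub_rpow)
  refine Integrable.mono' hdom ?_ ?_
  · exact (measurable_fst.mul
      ((measurable_density F t).comp continuous_coneMap.measurable)).aestronglyMeasurable
  · refine (ae_restrict_iff' measurableSet_unitSquare).2 (Filter.Eventually.of_forall fun p hp => ?_)
    have hg := conic_pos_of_fst_lt hp.1 (Ioo_subset_Icc_self hp.2)
    have h1 := one_le_conic_mul hp
    have h2 := h _ (coneMap_mem_simplex hp)
    rw [density_eq, Real.norm_eq_abs, abs_mul, abs_div, abs_of_pos hp.1.1, abs_of_pos (pow_pos hg _)]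
    set g := value conic (coneMap p)
    set D := (1 - p.1) ^ (-(1 / 2) : ℝ) * (p.2 ^ (-(1 / 2) : ℝ) + (1 - p.2) ^ (-(1 / 2) : ℝ))
    have h3 : |value F (coneMap p)| / g ^ (t + 1) ≤ M * D := by
      rw [div_le_iff₀ (pow_pos hg _)]
      calc _ ≤ M * g ^ t * 1 := by rw [mul_one]; exact h2
        _ ≤ M * g ^ t * (g * D) := by gcongr
        _ = _ := by ring
    calc p.1 * (|value F (coneMap p)| / g ^ (t + 1)) ≤ 1 * (|value F (coneMap p)| / g ^ (t + 1)) := by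
          gcongr
          exact hp.1.2.le
      _ ≤ _ := by rw [one_mul]; exact h3

/-! ### Stokes' theorem for radial fields -/

theorem eulerField_eq (F : MvPolynomial (Fin 2) ℚ) :
    eulerField F = X 0 * pderiv 0 F + X 1 * pderiv 1 F := by
  have : eulerField = (X 0 : MvPolynomial (Fin 2) ℚ) • pderiv 0
      + (X 1 : MvPolynomial (Fin 2) ℚ) • pderiv 1 := by
    refine derivation_ext fun i => ?_
    rw [eulerField_X]
    fin_cases i <;> simp [pderiv_X]
  rw [this]; rfl

theorem rotationField_eq (F : MvPolynomial (Fin 2) ℚ) :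
    rotationField F = X 0 * pderiv 1 F - X 1 * pderiv 0 F := by
  have : rotationField = (X 0 : MvPolynomial (Fin 2) ℚ) • pderiv 1
      - (X 1 : MvPolynomial (Fin 2) ℚ) • pderiv 0 := by
    refine derivation_ext fun i => ?_
    fin_cases i <;> simp [pderiv_X, rotationField_X_zero, rotationField_X_one]
  rw [this]; rfl

theorem hasDerivAt_value (F : MvPolynomial (Fin 2) ℚ) {a b : ℝ → ℝ} {a' b' s : ℝ}
    (ha : HasDerivAt a a' s) (hb : HasDerivAt b b' s) :
    HasDerivAt (fun s => value F (a s, b s))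
      (value (pderiv 0 F) (a s, b s) * a' + value (pderiv 1 F) (a s, b s) * b') s := by
  induction F using MvPolynomial.induction_on with
  | C r => simpa [value] using hasDerivAt_const s (r : ℝ)
  | add p q hp hq =>
    simp only [value_add, map_add]
    exact (hp.fun_add hq).congr_deriv (by ring)
  | mul_X p i hp =>
    fin_cases i
    · simp only [value_mul, Derivation.leibniz, value_add, smul_eq_mul, pderiv_X,
        Fin.zero_eta, value_X_zero]
      refine (hp.fun_mul ha).congr_deriv ?_
      simp [value]
      ring
    · simp only [value_mul, Derivation.leibniz, value_add, smul_eq_mul, pderiv_X,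
        Fin.mk_one, value_X_one]
      refine (hp.fun_mul hb).congr_deriv ?_
      simp [value]
      ring

theorem hasDerivAt_value_coneMap_fst (F : MvPolynomial (Fin 2) ℚ) (l y : ℝ) :
    HasDerivAt (fun l => value F (coneMap (l, y)))
      (value (pderiv 0 F) (coneMap (l, y)) * (1 - y) + value (pderiv 1 F) (coneMap (l, y)) * y) l :=
  hasDerivAt_value F ((hasDerivAt_id l).mul_const (1 - y) |>.congr_deriv (one_mul _))
    ((hasDerivAt_id l).mul_const y |>.congr_deriv (one_mul _))

theorem hasDerivAt_value_coneMap_snd (F : MvPolynomial (Fin 2) ℚ) (l y : ℝ) :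
    HasDerivAt (fun y => value F (coneMap (l, y)))
      (value (pderiv 0 F) (coneMap (l, y)) * (-l) + value (pderiv 1 F) (coneMap (l, y)) * l) y :=
  hasDerivAt_value F (((hasDerivAt_id y).const_sub 1).const_mul l |>.congr_deriv (by ring))
    ((hasDerivAt_id y).const_mul l |>.congr_deriv (mul_one _))

theorem value_eulerField_coneMap (F : MvPolynomial (Fin 2) ℚ) (l y : ℝ) :
    value (eulerField F) (coneMap (l, y)) = l * (value (pderiv 0 F) (coneMap (l, y)) * (1 - y)
      + value (pderiv 1 F) (coneMap (l, y)) * y) := by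
  rw [eulerField_eq, value_add, value_mul, value_mul, value_X_zero, value_X_one]
  simp only [coneMap]
  ring

theorem value_rotationField_coneMap (F : MvPolynomial (Fin 2) ℚ) (l y : ℝ) :
    value (rotationField F) (coneMap (l, y)) = l * (value (pderiv 1 F) (coneMap (l, y)) * (1 - y)
      - value (pderiv 0 F) (coneMap (l, y)) * y) := by
  rw [rotationField_eq, value_sub, value_mul, value_mul, value_X_zero, value_X_one]
  simp only [coneMap]
  ring

/-- The numerator over `g ^ (n + 1)` of the divergence of the radial vector field `(H / g ^ n) • E`,
where `g` is the conic and `E` the Euler field. -/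
def radialDivergence (H : MvPolynomial (Fin 2) ℚ) (n : ℕ) : MvPolynomial (Fin 2) ℚ :=
  (eulerField H + 2 * H) * conic + C (2 * n : ℚ) * (1 - conic) * H

theorem radialDivergence_mem {H : MvPolynomial (Fin 2) ℚ} {n : ℕ} (hH : H ∈ pointsIdeal ^ n) :
    radialDivergence H n ∈ pointsIdeal ^ n := by
  refine add_mem ?_ (Ideal.mul_mem_left _ _ hH)
  rw [add_mul]
  refine add_mem ?_ (Ideal.mul_mem_right _ _ (Ideal.mul_mem_left _ _ hH))
  rcases n with _ | n
  · simp
  · rw [pow_succ]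
    exact Ideal.mul_mem_mul (derivation_mem_pow _ _ _ _ hH) conic_mem_pointsIdeal

theorem continuousOn_density_coneMap_fst (F : MvPolynomial (Fin 2) ℚ) (t : ℕ) {y : ℝ}
    (hy : y ∈ Ioo (0 : ℝ) 1) :
    ContinuousOn (fun l => l * density F t (coneMap (l, y))) (Icc 0 1) := by
  have hc : Continuous fun l : ℝ => coneMap (l, y) := continuous_coneMap.comp (by fun_prop)
  simp only [density_eq]
  refine continuousOn_id.mul (ContinuousOn.div ((continuous_value F).comp hc).continuousOn
    (((continuous_value conic).comp hc).pow _).continuousOn fun l hl => ?_)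
  exact (pow_pos (conic_pos_of_snd_mem (p := (l, y)) hl hy) _).ne'

theorem continuousOn_density_coneMap_snd (F : MvPolynomial (Fin 2) ℚ) (t : ℕ) {l : ℝ}
    (hl : l ∈ Ioo (0 : ℝ) 1) :
    ContinuousOn (fun y => l * density F t (coneMap (l, y))) (Icc 0 1) := by
  have hc : Continuous fun y : ℝ => coneMap (l, y) := continuous_coneMap.comp (by fun_prop)
  simp only [density_eq]
  refine continuousOn_const.mul (ContinuousOn.div ((continuous_value F).comp hc).continuousOn
    (((continuous_value conic).comp hc).pow _).continuousOn fun y hy => ?_)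
  exact (pow_pos (conic_pos_of_fst_lt (p := (l, y)) hl hy) _).ne'

theorem hasDerivAt_radial (H : MvPolynomial (Fin 2) ℚ) (n : ℕ) {l y : ℝ}
    (hg : value conic (coneMap (l, y)) ≠ 0) :
    HasDerivAt (fun l => l ^ 2 * (value H (coneMap (l, y)) / value conic (coneMap (l, y)) ^ n))
      (l * density (radialDivergence H n) n (coneMap (l, y))) l := by
  have h1 := hasDerivAt_value_coneMap_fst H l y
  have e1 := value_eulerField_coneMap H l y
  set h' := value (pderiv 0 H) (coneMap (l, y)) * (1 - y) + value (pderiv 1 H) (coneMap (l, y)) * y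
  have h2 : HasDerivAt (fun l => value conic (coneMap (l, y)))
      (-(2 * l * (1 - 2 * y + 2 * y ^ 2))) l := by
    simp only [value_conic_coneMap]
    exact (((hasDerivAt_pow 2 l).mul_const _).const_sub 1).congr_deriv (by simp)
  refine ((hasDerivAt_pow 2 l).fun_mul (h1.fun_div (h2.fun_pow n) (pow_ne_zero _ hg))).congr_deriv ?_
  rw [density_eq, radialDivergence]
  simp only [value_add, value_mul, value_sub, value_C, value_one, value_two, e1]
  have e2 := value_conic_coneMap (l, y)
  simp only at e2
  have e3 : l * (1 - 2 * y + 2 * y ^ 2) * l = 1 - value conic (coneMap (l, y)) := by rw [e2]; ring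
  generalize value H (coneMap (l, y)) = h at *
  generalize value conic (coneMap (l, y)) = g at *
  -- The derivative of `g ^ n` contains `g ^ (n - 1)` with truncated subtraction, so `n = 0` is
  -- separate.
  rcases n with _ | n
  · simp
    field_simp
    ring
  · push_cast
    rw [← e3]
    field_simp
    ring

/-- The factor `l ^ 2` of the primitive removes the endpoint `l = 0`; at `l = 1` the conic equals
`2y(1 - y)`. -/
theorem integral_radial (H : MvPolynomial (Fin 2) ℚ) (n : ℕ) {y : ℝ} (hy : y ∈ Ioo (0 : ℝ) 1) :
    ∫ l in Ioo (0 : ℝ) 1, l * density (radialDivergence H n) n (coneMap (l, y))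
      = value H (1 - y, y) / (2 * (y * (1 - y))) ^ n := by
  rw [← integral_Ioc_eq_integral_Ioo, ← intervalIntegral.integral_of_le zero_le_one,
    intervalIntegral.integral_eq_sub_of_hasDerivAt
      (f := fun l => l ^ 2 * (value H (coneMap (l, y)) / value conic (coneMap (l, y)) ^ n))]
  · have : value conic (coneMap (1, y)) = 2 * (y * (1 - y)) := by
      rw [value_conic_coneMap]; ring
    rw [this]
    simp [coneMap]
  · intro l hl
    rw [uIcc_of_le zero_le_one] at hl
    exact hasDerivAt_radial H n (conic_pos_of_snd_mem (p := (l, y)) hl hy).ne'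
  · refine ContinuousOn.intervalIntegrable ?_
    rw [uIcc_of_le zero_le_one]
    exact continuousOn_density_coneMap_fst _ _ hy

theorem setIntegral_unitSquare_symm {f : ℝ × ℝ → ℝ} (hf : IntegrableOn f unitSquare) :
    ∫ p in unitSquare, f p = ∫ y in Ioo (0 : ℝ) 1, ∫ l in Ioo (0 : ℝ) 1, f (l, y) := by
  rw [IntegrableOn, volume_restrict_unitSquare] at hf
  rw [volume_restrict_unitSquare]
  exact integral_prod_symm f hf

theorem setIntegral_unitSquare {f : ℝ × ℝ → ℝ} (hf : IntegrableOn f unitSquare) :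
    ∫ p in unitSquare, f p = ∫ l in Ioo (0 : ℝ) 1, ∫ y in Ioo (0 : ℝ) 1, f (l, y) := by
  rw [IntegrableOn, volume_restrict_unitSquare] at hf
  rw [volume_restrict_unitSquare]
  exact integral_prod f hf

theorem exists_rat_eq_integral (p : Polynomial ℚ) :
    ∃ q : ℚ, ∫ y in Ioo (0 : ℝ) 1, Polynomial.aeval y p = q := by
  simp_rw [← integral_Ioc_eq_integral_Ioo, ← intervalIntegral.integral_of_le zero_le_one]
  induction p using Polynomial.induction_on' with
  | add p q hp hq =>
    obtain ⟨a, ha⟩ := hp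
    obtain ⟨b, hb⟩ := hq
    refine ⟨a + b, ?_⟩
    simp only [map_add]
    rw [intervalIntegral.integral_add ((Polynomial.continuous_aeval p).intervalIntegrable _ _)
      ((Polynomial.continuous_aeval q).intervalIntegrable _ _), ha, hb]
    push_cast; rfl
  | monomial n a =>
    refine ⟨a / (n + 1), ?_⟩
    simp [Polynomial.aeval_monomial, integral_pow]
    ring

theorem value_line (F : MvPolynomial (Fin 2) ℚ) (y : ℝ) :
    value F (1 - y, y) = Polynomial.aeval y (restrictLine F) := by
  have : aeval ![1 - y, y] = (Polynomial.aeval (R := ℚ) y).comp restrictLine := by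
    apply MvPolynomial.algHom_ext
    intro i
    fin_cases i <;> simp [restrictLine]
  exact DFunLike.congr_fun this F

theorem exists_value_line_div {H : MvPolynomial (Fin 2) ℚ} {n : ℕ} (hH : H ∈ pointsIdeal ^ n) :
    ∃ p : Polynomial ℚ, ∀ y ∈ Ioo (0 : ℝ) 1,
      value H (1 - y, y) / (2 * (y * (1 - y))) ^ n = Polynomial.aeval y p := by
  obtain ⟨p, hp⟩ := exists_restrictLine_eq hH
  refine ⟨Polynomial.C (1 / 2 ^ n) * p, fun y hy => ?_⟩
  have h0 : y * (1 - y) ≠ 0 := (mul_pos hy.1 (sub_pos.2 hy.2)).ne'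
  rw [value_line, hp]
  simp only [map_mul, map_pow, map_sub, map_one, Polynomial.aeval_X, Polynomial.aeval_C]
  rw [mul_pow 2]
  simp
  field_simp

theorem exists_rat_eq_integral_radial {H : MvPolynomial (Fin 2) ℚ} {n : ℕ}
    (hH : H ∈ pointsIdeal ^ n) :
    ∃ q : ℚ, ∫ p in unitSquare, p.1 * density (radialDivergence H n) n (coneMap p) = q := by
  obtain ⟨p, hp⟩ := exists_value_line_div hH
  obtain ⟨q, hq⟩ := exists_rat_eq_integral p
  refine ⟨q, ?_⟩
  rw [setIntegral_unitSquare_symm (integrableOn_density (radialDivergence_mem hH)), ← hq]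
  refine setIntegral_congr_fun measurableSet_Ioo fun y hy => ?_
  simp only [integral_radial H n hy, hp y hy]

/-! ### Stokes' theorem for the rotational field -/

/-- In cone coordinates `R = l (1 - 2y) ∂_l + (1 - 2y + 2y²) ∂_y`, and it has divergence zero. Hence
`l R(H / g)` is the `y`-derivative displayed here plus `(1 - 2y) ∂_l (l² H / g)`, the latter being
the radial term. -/
theorem hasDerivAt_rotational (H : MvPolynomial (Fin 2) ℚ) {l y : ℝ}
    (hg : value conic (coneMap (l, y)) ≠ 0) :
    HasDerivAt (fun y => l * (1 - 2 * y + 2 * y ^ 2) *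
        (value H (coneMap (l, y)) / value conic (coneMap (l, y))))
      (l * density (rotationField H) 0 (coneMap (l, y))
        - (1 - 2 * y) * (l * density (radialDivergence H 1) 1 (coneMap (l, y)))) y := by
  have h1 := hasDerivAt_value_coneMap_snd H l y
  have e1 := value_eulerField_coneMap H l y
  have e4 := value_rotationField_coneMap H l y
  have h0 : HasDerivAt (fun y : ℝ => 1 - 2 * y + 2 * y ^ 2) (4 * y - 2) y := by
    refine ((((hasDerivAt_id y).const_mul 2).const_sub 1).fun_add
      ((hasDerivAt_pow 2 y).const_mul 2)).congr_deriv ?_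
    simp
    ring
  have h2 : HasDerivAt (fun y => value conic (coneMap (l, y))) (-(l ^ 2 * (4 * y - 2))) y := by
    simp only [value_conic_coneMap]
    exact (h0.const_mul _).const_sub 1
  refine ((h0.const_mul l).fun_mul (h1.fun_div h2 hg)).congr_deriv ?_
  rw [density_eq, density_eq, radialDivergence]
  simp only [value_add, value_mul, value_sub, value_C, value_one, value_two, e1, e4]
  have e2 := value_conic_coneMap (l, y)
  simp only at e2
  have e3 : 1 - value conic (coneMap (l, y)) = l ^ 2 * (1 - 2 * y + 2 * y ^ 2) := by rw [e2]; ring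
  rw [e3]
  generalize value H (coneMap (l, y)) = h at *
  generalize value conic (coneMap (l, y)) = g at *
  push_cast
  field_simp
  ring

theorem value_zero_eq {H : MvPolynomial (Fin 2) ℚ} (hH : sigma H = H) (l : ℝ) :
    value H (0, l) = value H (l, 0) := by
  have : (aeval ![l, 0]).comp sigma = aeval ![(0 : ℝ), l] := by
    apply MvPolynomial.algHom_ext
    intro i
    fin_cases i <;> simp [sigma]
  have h := DFunLike.congr_fun this H
  rw [AlgHom.comp_apply, hH] at h
  exact h.symm

theorem integral_rotational {H : MvPolynomial (Fin 2) ℚ} (hH : sigma H = H) {l : ℝ}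
    (hl : l ∈ Ioo (0 : ℝ) 1) :
    ∫ y in Ioo (0 : ℝ) 1, (l * density (rotationField H) 0 (coneMap (l, y))
        - (1 - 2 * y) * (l * density (radialDivergence H 1) 1 (coneMap (l, y)))) = 0 := by
  rw [← integral_Ioc_eq_integral_Ioo, ← intervalIntegral.integral_of_le zero_le_one,
    intervalIntegral.integral_eq_sub_of_hasDerivAt
      (f := fun y => l * (1 - 2 * y + 2 * y ^ 2) *
        (value H (coneMap (l, y)) / value conic (coneMap (l, y))))]
  · have := value_zero_eq hH l
    simp only [value_conic_coneMap]
    norm_num [coneMap, this]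
  · intro y hy
    rw [uIcc_of_le zero_le_one] at hy
    exact hasDerivAt_rotational H (conic_pos_of_fst_lt (p := (l, y)) hl hy).ne'
  · refine ContinuousOn.intervalIntegrable ?_
    rw [uIcc_of_le zero_le_one]
    refine (continuousOn_density_coneMap_snd _ _ hl).sub
      (ContinuousOn.mul (by fun_prop) (continuousOn_density_coneMap_snd _ _ hl))

theorem exists_rat_eq_integral_rotational {H : MvPolynomial (Fin 2) ℚ} (hσ : sigma H = H)
    (hH : H ∈ pointsIdeal) :
    ∃ q : ℚ, ∫ p in unitSquare, p.1 * density (rotationField H) 0 (coneMap p) = q := by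
  have hH1 : H ∈ pointsIdeal ^ 1 := by rwa [pow_one]
  obtain ⟨p, hp⟩ := exists_value_line_div hH1
  obtain ⟨q, hq⟩ := exists_rat_eq_integral ((1 - 2 * Polynomial.X) * p)
  have i1 : IntegrableOn (fun p => p.1 * density (rotationField H) 0 (coneMap p)) unitSquare :=
    integrableOn_density (by simp)
  have i2 : IntegrableOn (fun p : ℝ × ℝ =>
      (1 - 2 * p.2) * (p.1 * density (radialDivergence H 1) 1 (coneMap p))) unitSquare := by
    refine (integrableOn_density (radialDivergence_mem hH1)).bdd_mul (c := 1)
      (by fun_prop) ?_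
    refine (ae_restrict_iff' measurableSet_unitSquare).2 (Filter.Eventually.of_forall fun p hp => ?_)
    rw [Real.norm_eq_abs, abs_le]
    exact ⟨by linarith [hp.2.2], by linarith [hp.2.1]⟩
  refine ⟨q, ?_⟩
  -- The difference is integrated over `y` first, where it is exact with equal endpoint values; the
  -- radial term is later integrated over `l` first. Absolute convergence permits both orders.
  have h0 := setIntegral_unitSquare (i1.sub i2)
  simp only [Pi.sub_apply] at h0
  rw [setIntegral_congr_fun (g := fun _ => 0) measurableSet_Ioo
    fun l hl => integral_rotational hσ hl] at h0
  have h1 := integral_sub i1 i2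
  rw [integral_zero] at h0
  rw [h0, eq_comm, sub_eq_zero] at h1
  rw [h1, setIntegral_unitSquare_symm i2, ← hq]
  refine setIntegral_congr_fun measurableSet_Ioo fun y hy => ?_
  have h2 : Polynomial.aeval y (2 : Polynomial ℚ) = 2 := map_ofNat _ 2
  simp only [integral_const_mul, integral_radial H 1 hy, hp y hy, map_mul, map_sub, map_one,
    Polynomial.aeval_X, h2]

/-! ### The Catalan constant as the integral of the inverse conic -/

theorem hasDerivAt_neg_log_conic {l y : ℝ} (hg : value conic (coneMap (l, y)) ≠ 0) :
    HasDerivAt (fun l => -Real.log (value conic (coneMap (l, y))) / (2 * (1 - 2 * y + 2 * y ^ 2)))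
      (l * density 1 0 (coneMap (l, y))) l := by
  have hq : 1 - 2 * y + 2 * y ^ 2 ≠ 0 := by nlinarith [sq_nonneg (1 - 2 * y)]
  have h2 : HasDerivAt (fun l => value conic (coneMap (l, y)))
      (-(2 * l * (1 - 2 * y + 2 * y ^ 2))) l := by
    simp only [value_conic_coneMap]
    exact (((hasDerivAt_pow 2 l).mul_const _).const_sub 1).congr_deriv (by simp)
  refine ((h2.log hg).fun_neg.div_const _).congr_deriv ?_
  rw [density_eq, value_one]
  generalize value conic (coneMap (l, y)) = g at *
  generalize 1 - 2 * y + 2 * y ^ 2 = q at *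
  field_simp
  ring

theorem integral_density_one {y : ℝ} (hy : y ∈ Ioo (0 : ℝ) 1) :
    ∫ l in Ioo (0 : ℝ) 1, l * density 1 0 (coneMap (l, y))
      = -Real.log (2 * (y * (1 - y))) / (2 * (1 - 2 * y + 2 * y ^ 2)) := by
  rw [← integral_Ioc_eq_integral_Ioo, ← intervalIntegral.integral_of_le zero_le_one,
    intervalIntegral.integral_eq_sub_of_hasDerivAt (f := fun l =>
      -Real.log (value conic (coneMap (l, y))) / (2 * (1 - 2 * y + 2 * y ^ 2)))]
  · have : value conic (coneMap (1, y)) = 2 * (y * (1 - y)) := by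
      rw [value_conic_coneMap]; ring
    rw [this]
    simp [value_conic_coneMap]
  · intro l hl
    rw [uIcc_of_le zero_le_one] at hl
    exact hasDerivAt_neg_log_conic (conic_pos_of_snd_mem (p := (l, y)) hl hy).ne'
  · refine ContinuousOn.intervalIntegrable ?_
    rw [uIcc_of_le zero_le_one]
    exact continuousOn_density_coneMap_fst _ _ hy

theorem setIntegral_Ioo_comp {f f' : ℝ → ℝ} {s : Set ℝ}
    (hf : ∀ x ∈ Ioo (0 : ℝ) 1, HasDerivAt f (f' x) x) (hinj : InjOn f (Ioo 0 1))
    (hs : f '' Ioo 0 1 = s) (g : ℝ → ℝ) :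
    ∫ x in s, g x = ∫ x in Ioo (0 : ℝ) 1, |f' x| * g (f x) := by
  rw [← hs, integral_image_eq_integral_abs_deriv_smul measurableSet_Ioo
    (fun x hx => (hf x hx).hasDerivWithinAt) hinj]
  rfl

/-- Serret's integral: `∫ log (1 + v) / (1 + v ^ 2) = (π / 8) log 2`, in a form without `π`. -/
theorem integral_serret :
    ∫ v in Ioo (0 : ℝ) 1, (2 * Real.log (1 + v) - Real.log 2) / (1 + v ^ 2) = 0 := by
  have hd : ∀ x ∈ Ioo (0 : ℝ) 1,
      HasDerivAt (fun v : ℝ => (1 - v) / (1 + v)) (-(2 / (1 + x) ^ 2)) x := by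
    intro x hx
    have h0 : 1 + x ≠ 0 := by linarith [hx.1]
    refine (((hasDerivAt_id x).const_sub 1).fun_div ((hasDerivAt_id x).const_add 1)
      h0).congr_deriv ?_
    simp only [id]
    field_simp
    ring
  have hinv : ∀ x ∈ Ioo (0 : ℝ) 1, (1 - (1 - x) / (1 + x)) / (1 + (1 - x) / (1 + x)) = x := by
    intro x hx
    have h0 : 1 + x ≠ 0 := by linarith [hx.1]
    field_simp
    ring
  have hmaps : MapsTo (fun v : ℝ => (1 - v) / (1 + v)) (Ioo 0 1) (Ioo 0 1) := by
    intro x hx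
    have h0 : 0 < 1 + x := by linarith [hx.1]
    refine ⟨div_pos (by linarith [hx.2]) h0, ?_⟩
    simp only
    rw [div_lt_one h0]
    linarith [hx.1]
  -- The involution `v ↦ (1 - v) / (1 + v)` of the interval changes the sign of the integrand,
  -- Jacobian included.
  have h := setIntegral_Ioo_comp (s := Ioo 0 1) hd
    (LeftInvOn.injOn (f₁' := fun v : ℝ => (1 - v) / (1 + v)) hinv)
    (Subset.antisymm hmaps.image_subset fun x hx => ⟨_, hmaps hx, hinv x hx⟩)
    fun v => (2 * Real.log (1 + v) - Real.log 2) / (1 + v ^ 2)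
  have h2 : ∫ x in Ioo (0 : ℝ) 1, |-(2 / (1 + x) ^ 2)| *
      ((2 * Real.log (1 + (1 - x) / (1 + x)) - Real.log 2) / (1 + ((1 - x) / (1 + x)) ^ 2))
      = ∫ x in Ioo (0 : ℝ) 1, -((2 * Real.log (1 + x) - Real.log 2) / (1 + x ^ 2)) := by
    refine setIntegral_congr_fun measurableSet_Ioo fun x hx => ?_
    have h0 : 0 < 1 + x := by linarith [hx.1]
    have h1 : 1 + (1 - x) / (1 + x) = 2 / (1 + x) := by field_simp; ring
    have h3 : 1 + ((1 - x) / (1 + x)) ^ 2 = 2 * (1 + x ^ 2) / (1 + x) ^ 2 := by field_simp; ring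
    rw [h1, h3, Real.log_div two_ne_zero h0.ne', abs_neg, abs_of_pos (by positivity)]
    field_simp
    ring
  rw [h2, integral_neg] at h
  linarith

theorem intervalIntegrable_pow_mul_log (m : ℕ) :
    IntervalIntegrable (fun v : ℝ => v ^ m * -Real.log v) volume 0 1 :=
  (intervalIntegral.intervalIntegrable_log'.neg).continuousOn_mul (by fun_prop)

theorem integral_pow_mul_neg_log (m : ℕ) :
    ∫ v in Ioo (0 : ℝ) 1, v ^ m * -Real.log v = 1 / ((m : ℝ) + 1) ^ 2 := by
  rw [← integral_Ioc_eq_integral_Ioo, ← intervalIntegral.integral_of_le zero_le_one,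
    intervalIntegral.integral_eq_sub_of_hasDerivAt_of_le zero_le_one
      -- Grouping `v * Real.log v` makes continuity at `0` evident; differentiability is needed only
      -- in the open interval.
      (f := fun v => -(v ^ m * (v * Real.log v)) / (m + 1) + v ^ (m + 1) / ((m : ℝ) + 1) ^ 2)
      ?_ ?_ (intervalIntegrable_pow_mul_log m)]
  · simp
  · have := Real.continuous_mul_log
    fun_prop
  · intro v hv
    have h1 := ((((hasDerivAt_pow (m + 1) v).fun_mul (Real.hasDerivAt_log hv.1.ne')).fun_neg).div_const
      ((m : ℝ) + 1)).fun_add ((hasDerivAt_pow (m + 1) v).div_const (((m : ℝ) + 1) ^ 2))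
    have h2 : (fun v : ℝ => -(v ^ m * (v * Real.log v)) / (m + 1) + v ^ (m + 1) / ((m : ℝ) + 1) ^ 2)
        = fun v => -(v ^ (m + 1) * Real.log v) / (m + 1) + v ^ (m + 1) / ((m : ℝ) + 1) ^ 2 := by
      funext v
      ring
    rw [h2]
    refine h1.congr_deriv ?_
    have hv0 := hv.1.ne'
    have : (m : ℝ) + 1 ≠ 0 := by positivity
    push_cast
    field_simp
    ring

/-- Expand `1 / (1 + v²)` as a geometric series and integrate termwise; the norms of the terms have
the summable integrals `1 / (2n + 1)²`. -/
theorem integral_neg_log_div :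
    ∫ v in Ioo (0 : ℝ) 1, -Real.log v / (1 + v ^ 2) = catalanConstant := by
  have hint : ∀ n : ℕ, Integrable (fun v : ℝ => (-1) ^ n * (v ^ (2 * n) * -Real.log v))
      (volume.restrict (Ioo 0 1)) := by
    intro n
    have := intervalIntegrable_pow_mul_log (2 * n)
    rw [intervalIntegrable_iff_integrableOn_Ioo_of_le zero_le_one] at this
    exact this.const_mul _
  have hnorm : ∀ n : ℕ, ∫ v in Ioo (0 : ℝ) 1, ‖(-1) ^ n * (v ^ (2 * n) * -Real.log v)‖
      = 1 / (2 * (n : ℝ) + 1) ^ 2 := by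
    intro n
    have := integral_pow_mul_neg_log (2 * n)
    push_cast at this
    rw [← this]
    refine setIntegral_congr_fun measurableSet_Ioo fun v hv => ?_
    simp only [norm_mul, norm_pow, norm_neg, norm_one, one_pow, one_mul]
    rw [Real.norm_of_nonneg hv.1.le, Real.norm_of_nonpos (Real.log_nonpos hv.1.le hv.2.le)]
  have hsum : Summable fun n : ℕ => ∫ v in Ioo (0 : ℝ) 1, ‖(-1) ^ n * (v ^ (2 * n) * -Real.log v)‖ := by
    simp_rw [hnorm]
    refine Summable.of_nonneg_of_le (fun n => by positivity) (fun n => ?_)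
      ((summable_nat_add_iff 1).2 (Real.summable_one_div_nat_pow.2 one_lt_two))
    push_cast
    gcongr
    linarith [(Nat.cast_nonneg n : (0 : ℝ) ≤ n)]
  have h := (hasSum_integral_of_summable_integral_norm hint hsum).tsum_eq
  have h1 : ∀ n : ℕ, ∫ v in Ioo (0 : ℝ) 1, (-1) ^ n * (v ^ (2 * n) * -Real.log v)
      = (-1) ^ n / (2 * (n : ℝ) + 1) ^ 2 := by
    intro n
    rw [integral_const_mul, integral_pow_mul_neg_log]
    push_cast
    ring
  simp_rw [h1] at h
  rw [catalanConstant, h]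
  refine setIntegral_congr_fun measurableSet_Ioo fun v hv => ?_
  have hv2 : ‖-v ^ 2‖ < 1 := by
    rw [norm_neg, Real.norm_of_nonneg (sq_nonneg v)]
    nlinarith [hv.1, hv.2]
  have h3 := (hasSum_geometric_of_norm_lt_one hv2).mul_right (-Real.log v)
  rw [div_eq_mul_inv, mul_comm, ← sub_neg_eq_add 1, ← h3.tsum_eq]
  refine tsum_congr fun n => ?_
  rw [neg_pow (v ^ 2), ← pow_mul]
  ring

/-- Under `y = v / (1 + v)` the integrand becomes `(-log v + 2 log (1 + v) - log 2) / (1 + v²)`. The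
first term gives the Catalan constant and Serret's integral removes the rest. -/
theorem integral_half :
    ∫ y in Ioo (0 : ℝ) (1 / 2), -Real.log (2 * (y * (1 - y))) / (1 - 2 * y + 2 * y ^ 2)
      = catalanConstant := by
  have hd : ∀ x ∈ Ioo (0 : ℝ) 1, HasDerivAt (fun v : ℝ => v / (1 + v)) (1 / (1 + x) ^ 2) x := by
    intro x hx
    have h0 : 1 + x ≠ 0 := by linarith [hx.1]
    refine ((hasDerivAt_id x).fun_div ((hasDerivAt_id x).const_add 1) h0).congr_deriv ?_
    simp
  have hinj : InjOn (fun v : ℝ => v / (1 + v)) (Ioo 0 1) := by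
    intro a ha b hb h
    have h0 : 1 + a ≠ 0 := by linarith [ha.1]
    have h1 : 1 + b ≠ 0 := by linarith [hb.1]
    simp only at h
    rw [div_eq_div_iff h0 h1] at h
    linarith
  have himage : (fun v : ℝ => v / (1 + v)) '' Ioo 0 1 = Ioo 0 (1 / 2) := by
    apply Subset.antisymm
    · rintro _ ⟨v, hv, rfl⟩
      have h0 : 0 < 1 + v := by linarith [hv.1]
      refine ⟨div_pos hv.1 h0, ?_⟩
      simp only
      rw [div_lt_iff₀ h0]
      linarith [hv.2]
    · intro y hy
      have h0 : 0 < 1 - y := by linarith [hy.2]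
      refine ⟨y / (1 - y), ⟨div_pos hy.1 h0, ?_⟩, ?_⟩
      · rw [div_lt_one h0]; linarith [hy.2]
      · simp only
        field_simp
        ring
  rw [setIntegral_Ioo_comp hd hinj himage]
  refine Eq.trans ?_ ((congrArg₂ (· + ·) integral_neg_log_div integral_serret).trans (add_zero _))
  rw [← integral_add]
  · refine setIntegral_congr_fun measurableSet_Ioo fun v hv => ?_
    have hv0 := hv.1
    have h0 : 0 < 1 + v := by linarith [hv.1]
    have h1 : 2 * (v / (1 + v) * (1 - v / (1 + v))) = 2 * v / (1 + v) ^ 2 := by field_simp; ring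
    have h3 : 1 - 2 * (v / (1 + v)) + 2 * (v / (1 + v)) ^ 2 = (1 + v ^ 2) / (1 + v) ^ 2 := by
      field_simp; ring
    rw [h1, h3, abs_of_pos (by positivity), Real.log_div (by positivity) (by positivity),
      Real.log_mul two_ne_zero hv0.ne', Real.log_pow]
    field_simp
    push_cast
    ring
  · have := (intervalIntegrable_pow_mul_log 0).mul_continuousOn (g := fun v : ℝ => (1 + v ^ 2)⁻¹)
      (ContinuousOn.inv₀ (by fun_prop) fun v _ => by positivity)
    rw [intervalIntegrable_iff_integrableOn_Ioo_of_le zero_le_one] at this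
    simpa [div_eq_mul_inv, IntegrableOn] using this
  · refine IntegrableOn.mono_set (t := Icc (0 : ℝ) 1) (ContinuousOn.integrableOn_Icc ?_) Ioo_subset_Icc_self
    refine ContinuousOn.div ?_ (by fun_prop) fun v _ => by positivity
    refine ContinuousOn.sub (ContinuousOn.mul (by fun_prop) (ContinuousOn.log (by fun_prop) ?_))
      (by fun_prop)
    intro v hv
    linarith [hv.1]

theorem integral_unitSquare_density_one :
    ∫ p in unitSquare, p.1 * density 1 0 (coneMap p) = catalanConstant := by
  have hi : IntegrableOn (fun p : ℝ × ℝ => p.1 * density 1 0 (coneMap p)) unitSquare :=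
    integrableOn_density (by simp)
  rw [setIntegral_unitSquare_symm hi]
  rw [IntegrableOn, volume_restrict_unitSquare] at hi
  have hi2 := hi.integral_prod_right
  set f : ℝ → ℝ := fun y => ∫ l in Ioo (0 : ℝ) 1, l * density 1 0 (coneMap (l, y)) with hf
  have hfy : ∀ y ∈ Ioo (0 : ℝ) 1,
      f y = -Real.log (2 * (y * (1 - y))) / (2 * (1 - 2 * y + 2 * y ^ 2)) :=
    fun y hy => integral_density_one hy
  have hii : IntervalIntegrable f volume 0 1 := by
    rw [intervalIntegrable_iff_integrableOn_Ioo_of_le zero_le_one]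
    exact hi2
  have hsub : uIcc (0 : ℝ) (1 / 2) ⊆ uIcc 0 1 := by
    rw [uIcc_of_le (by norm_num), uIcc_of_le zero_le_one]
    exact Icc_subset_Icc_right (by norm_num)
  have hsub' : uIcc (1 / 2 : ℝ) 1 ⊆ uIcc 0 1 := by
    rw [uIcc_of_le (by norm_num), uIcc_of_le zero_le_one]
    exact Icc_subset_Icc_left (by norm_num)
  -- The symmetry `y ↦ 1 - y` folds the integral onto `(0, 1/2)`; the resulting factor two cancels
  -- the two in the denominator of `hfy`.
  have hsymm : ∫ y in (1 / 2 : ℝ)..1, f y = ∫ y in (0 : ℝ)..1 / 2, f y := by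
    have := intervalIntegral.integral_comp_sub_left (a := 0) (b := 1 / 2) f 1
    rw [show (1 : ℝ) - 1 / 2 = 1 / 2 by norm_num, sub_zero] at this
    rw [← this, intervalIntegral.integral_of_le (by norm_num), intervalIntegral.integral_of_le
      (by norm_num), integral_Ioc_eq_integral_Ioo, integral_Ioc_eq_integral_Ioo]
    refine setIntegral_congr_fun measurableSet_Ioo fun y hy => ?_
    have h1 : y ∈ Ioo (0 : ℝ) 1 := ⟨hy.1, by linarith [hy.2]⟩
    have h2 : 1 - y ∈ Ioo (0 : ℝ) 1 := ⟨by linarith [hy.2], by linarith [hy.1]⟩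
    rw [hfy _ h1, hfy _ h2, show (1 - y) * (1 - (1 - y)) = y * (1 - y) by ring,
      show 1 - 2 * (1 - y) + 2 * (1 - y) ^ 2 = 1 - 2 * y + 2 * y ^ 2 by ring]
  rw [← integral_Ioc_eq_integral_Ioo, ← intervalIntegral.integral_of_le zero_le_one,
    ← intervalIntegral.integral_add_adjacent_intervals (hii.mono_set hsub) (hii.mono_set hsub'),
    hsymm, ← two_mul, intervalIntegral.integral_of_le (by norm_num), integral_Ioc_eq_integral_Ioo,
    ← integral_const_mul, ← integral_half]
  refine setIntegral_congr_fun measurableSet_Ioo fun y hy => ?_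
  have hq : 1 - 2 * y + 2 * y ^ 2 ≠ 0 := by nlinarith [sq_nonneg (1 - 2 * y)]
  rw [hfy y ⟨hy.1, by linarith [hy.2]⟩]
  field_simp

/-! ### Induction on the pole order -/

theorem exists_rat_eq_integral_polynomial (A : MvPolynomial (Fin 2) ℚ) :
    ∃ q : ℚ, ∫ p in unitSquare, p.1 * density (conic * A) 0 (coneMap p) = q := by
  obtain ⟨H, rfl⟩ := exists_eulerField_add_two_mul A
  obtain ⟨q, hq⟩ := exists_rat_eq_integral_radial (H := H) (n := 0) (by simp)
  refine ⟨q, hq ▸ ?_⟩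
  have : radialDivergence H 0 = conic * (eulerField H + 2 * H) := by
    simp [radialDivergence, mul_comm]
  rw [this]

theorem density_add (F G : MvPolynomial (Fin 2) ℚ) (t : ℕ) (p : ℝ × ℝ) :
    density (F + G) t p = density F t p + density G t p := by
  simp only [density_eq, value_add, add_div]

theorem density_C_mul (c : ℚ) (F : MvPolynomial (Fin 2) ℚ) (t : ℕ) (p : ℝ × ℝ) :
    density (C c * F) t p = c * density F t p := by
  simp only [density_eq, value_mul, value_C, mul_div_assoc]

theorem setIntegral_density_add {F G : MvPolynomial (Fin 2) ℚ} {t : ℕ}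
    (hF : F ∈ pointsIdeal ^ t) (hG : G ∈ pointsIdeal ^ t) :
    ∫ p in unitSquare, p.1 * density (F + G) t (coneMap p)
      = (∫ p in unitSquare, p.1 * density F t (coneMap p))
        + ∫ p in unitSquare, p.1 * density G t (coneMap p) := by
  rw [← integral_add (integrableOn_density hF) (integrableOn_density hG)]
  simp only [density_add, mul_add]

theorem setIntegral_density_C_mul (c : ℚ) (F : MvPolynomial (Fin 2) ℚ) (t : ℕ) :
    ∫ p in unitSquare, p.1 * density (C c * F) t (coneMap p)
      = c * ∫ p in unitSquare, p.1 * density F t (coneMap p) := by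
  rw [← integral_const_mul]
  simp only [density_C_mul, mul_left_comm]

theorem setIntegral_density_conic_mul (F : MvPolynomial (Fin 2) ℚ) (t : ℕ) :
    ∫ p in unitSquare, p.1 * density (conic * F) (t + 1) (coneMap p)
      = ∫ p in unitSquare, p.1 * density F t (coneMap p) := by
  refine setIntegral_congr_fun measurableSet_unitSquare fun p hp => ?_
  have hg := (conic_pos_of_fst_lt hp.1 (Ioo_subset_Icc_self hp.2)).ne'
  simp only [density_eq, value_mul]
  rw [pow_succ' _ (t + 1), mul_div_mul_left _ _ hg]

theorem exists_integral_eq (t : ℕ) : ∀ F : MvPolynomial (Fin 2) ℚ, sigma F = F →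
    F ∈ pointsIdeal ^ t → ∃ a b : ℚ, ∫ p in unitSquare, p.1 * density F t (coneMap p)
      = a + b * catalanConstant := by
  induction t with
  | zero =>
    intro F hF _
    obtain ⟨c, A, H, rfl, hσ, hH⟩ := exists_sigma_invariant_primitive hF
    obtain ⟨q, hq⟩ := exists_rat_eq_integral_polynomial A
    obtain ⟨r, hr⟩ := exists_rat_eq_integral_rotational hσ hH
    refine ⟨q + r, c, ?_⟩
    rw [setIntegral_density_add (by simp) (by simp), setIntegral_density_add (by simp) (by simp),
      hq, hr, ← mul_one (C c), setIntegral_density_C_mul, integral_unitSquare_density_one]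
    push_cast
    ring
  | succ t ih =>
    intro F hF hFt
    -- Chosen so that `c` times `radialDivergence F (t + 1)` agrees with `F` modulo the conic; the
    -- quotient of the difference by the conic is `F'`.
    set c : ℚ := 1 / (2 * (t + 1)) with hc
    set F' := F - C c * (eulerField F + 2 * F) with hF'
    have hmem : F' ∈ pointsIdeal ^ t := by
      have h1 := Ideal.pow_le_pow_right (Nat.le_succ t) hFt
      refine sub_mem h1 (Ideal.mul_mem_left _ _ (add_mem ?_ (Ideal.mul_mem_left _ _ h1)))
      exact derivation_mem_pow _ _ _ _ hFt
    obtain ⟨a, b, hab⟩ := ih F' (sigma_poleReduction hF c) hmem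
    obtain ⟨q, hq⟩ := exists_rat_eq_integral_radial hFt
    refine ⟨c * q + a, b, ?_⟩
    have key : F = C c * radialDivergence F (t + 1) + conic * F' := by
      have h : C c * C (2 * ((t + 1 : ℕ) : ℚ)) = (1 : MvPolynomial (Fin 2) ℚ) := by
        rw [← C_mul, hc]
        push_cast
        rw [one_div_mul_cancel (by positivity), C_1]
      rw [hF', radialDivergence]
      linear_combination -((1 - conic) * F) * h
    have e : ∫ p in unitSquare, p.1 * density F (t + 1) (coneMap p)
        = ∫ p in unitSquare, p.1 *
          density (C c * radialDivergence F (t + 1) + conic * F') (t + 1) (coneMap p) := by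
      rw [← key]
    rw [e, setIntegral_density_add (Ideal.mul_mem_left _ _ (radialDivergence_mem hFt))
      (by rw [pow_succ']; exact Ideal.mul_mem_mul conic_mem_pointsIdeal hmem),
      setIntegral_density_C_mul, setIntegral_density_conic_mul, hq, hab]
    push_cast
    ring

end

end CatalanForms

/-- If `F` is `σ`-invariant and `ω_{F,t}` is integrable, then the integral of `ω_{F,t}` over the
simplex `Δ` converges (absolutely) to a rational linear combination of `1` and the Catalan
constant. -/
theorem mainTheorem3 (t : ℕ) (F : MvPolynomial (Fin 2) ℚ)
    (hσ : CatalanForms.sigma F = F) (hF : CatalanForms.IsIntegrableForm F t) :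
    IntegrableOn (CatalanForms.density F t) CatalanForms.simplex volume ∧
      ∃ a b : ℚ, ∫ p in CatalanForms.simplex, CatalanForms.density F t p =
        (a : ℝ) + (b : ℝ) * CatalanForms.catalanConstant := by
  have h := CatalanForms.mem_pointsIdeal_pow_of_isIntegrableForm hF
  rw [CatalanForms.integrableOn_simplex_iff, CatalanForms.setIntegral_simplex]
  exact ⟨CatalanForms.integrableOn_density h, CatalanForms.exists_integral_eq t F hσ h⟩
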